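/- **Setting.** Let $\mathcal B$ be the ring of bounded Borel subsets of $\mathbb R$. A *b-measure* is a map $\mu\colon\mathcal B\to\mathbb R$ with $\mu(\emptyset)=0$, with $\mu(\bigcup_n A_n)=\sum_n\mu(A_n)$ for all pairwise disjoint $A_n\in\mathcal B$ such that $\bigcup_n A_n\in\mathcal B$, and with $\mu(\{t\})=0$ for all $t\in\mathbb R$. Its total variation is $|\mu|(A)=\sup\sum_{i}|\mu(A_i)|$, the supremum being over all finite Borel partitions $\{A_i\}$ of $A\in\mathcal B$. Let $\mathcal M_c^+$ be the set of locally finite regular positive Borel measures on $\mathbb R$ without atoms, let $B_j$ be the closed ball of $\mathbb R^N$ with centre $0$ and radius $j$, and write $\mathbb R^+=[0,\infty)$. Fix moduli of continuity $\omega_j\colon\mathbb R^+\to\mathbb R^+$, $j\ge1$: each $\omega_j$ is continuous and non-decreasing, $\omega_j(0)=0$ and $\omega_j\le\omega_{j+1}$. The vector space $\mathfrak{M_p}$ of *parametric b-measures* consists of all maps $y\mapsto\nu_y$ from $\mathbb R^N$ to the b-measures such that for each integer $j\ge1$ there are $m_j,l_j\in\mathcal M_c^+$ (an *$m$-bound*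 and an *$l$-bound* of $\nu$ on $B_j$) with $|\nu_y|(A)\le m_j(A)$ and $|\nu_{y_1}-\nu_{y_2}|(A)\le l_j(A)\,\omega_j(|y_1-y_2|)$ for all $A\in\mathcal B$ and $y,y_1,y_2\in B_j$. For a continuous curve $y\colon[a,b]\to\mathbb R^N$, the integral $\int_a^b d\nu_{y(s)}$ is the limit of the Riemann sums $\sum_i\nu_{y(\tau_i)}([t_i,t_{i+1}])$ over tagged partitions of $[a,b]$ as the mesh tends to $0$. The translate of $\nu\in\mathfrak{M_p}$ by $t\in\mathbb R$ is $\nu{\cdot}t\in\mathfrak{M_p}$, $(\nu{\cdot}t)_y(A)=\nu_y(A+t)$. **Topologies.** Below, $I=[q_1,q_2]$ runs over the intervals with rational endpoints $q_1<q_2$, and $j$ over the integers $j\ge1$. A *suitable set of moduli of continuity* is a family $\Theta=\{\theta_j^I\}_{j,I}$ of continuous non-decreasing functions $\theta_j^I\colon\mathbb R^+\to\mathbb R^+$ with $\theta_j^I(0)=0$ and $\theta_{j_1}^{I_1}\le\theta_{j_2}^{I_2}$ whenever $I_1\subseteq I_2$ and $j_1\le j_2$. For such $\Theta$, $\sigma_\Theta$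 is the topology on $\mathfrak{M_p}$ generated by the seminorms $$p_{I,j}(\nu)=\sup_{y\in\mathcal K_j^I}\Big|\int_I d\nu_{y(s)}\Big|,$$ where $\mathcal K_j^I$ is the set of $y\in C(I,B_j)$ with $|y(t_1)-y(t_2)|\le\theta_j^I(|t_1-t_2|)$ for all $t_1,t_2\in I$. For a countable dense set $D\subset\mathbb R^N$, $\sigma_D$ is the topology on $\mathfrak{M_p}$ generated by the seminorms $p_{I,y}(\nu)=|\nu_y(I)|$, $y\in D$. **Bounds and hull.** A family $(\mu_\alpha)$ in $\mathcal M_c^+$ is *bounded* if there is $c>0$ with $\mu_\alpha([t,t+1])\le c$ for all $t\in\mathbb R$ and all $\alpha$; it is *equicontinuous* if for every $\varepsilon>0$ there is $\delta>0$ with $\mu_\alpha([s,t])<\varepsilon$ for all $\alpha$ whenever $0\le t-s<\delta$. We say that $\nu\in\mathfrak{M_p}$ has *equicontinuous $m$-bounds* (resp. *bounded $l$-bounds*) if for every $j\ge1$ one can choose $m$-bounds (resp. $l$-bounds) on $B_j$ of the translates $\nu{\cdot}t$, $t\in\mathbb R$, that form an equicontinuous (resp. bounded) family. For a topology $\mathcal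 T$ on $\mathfrak{M_p}$, $\mathrm{Hull}_{\mathcal T}(\nu)$ is the $\mathcal T$-closure of $\{\nu{\cdot}t: t\in\mathbb R\}$ with the topology induced by $\mathcal T$. **Statement.** Let $\nu_0\in\mathfrak{M_p}$ have equicontinuous $m$-bounds, and let $\mathcal T$ be either $\sigma_\Theta$ for a suitable set of moduli of continuity $\Theta$, or $\sigma_D$ for a countable dense set $D\subset\mathbb R^N$. Then the map $$\varphi\colon\mathbb R\times\mathrm{Hull}_{\mathcal T}(\nu_0)\to\mathrm{Hull}_{\mathcal T}(\nu_0),\qquad \varphi(t,\nu)=\nu{\cdot}t,$$ is well defined and is a continuous flow: it is jointly continuous, $\varphi(0,\nu)=\nu$ and $\varphi(t+s,\nu)=\varphi(t,\varphi(s,\nu))$ for all $t,s\in\mathbb R$ and $\nu\in\mathrm{Hull}_{\mathcal T}(\nu_0)$. If, in addition, $\nu_0$ has bounded $l$-bounds, then $\mathrm{Hull}_{\mathcal T}(\nu_0)$ is compact. -/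

import Mathlib

open Set
open scoped NNReal ENNReal

/-- The ring `𝓑` of bounded Borel subsets of the real line. -/
def IsBoundedBorel (A : Set ℝ) : Prop :=
  MeasurableSet A ∧ Bornology.IsBounded A

/-- A continuous real b-measure: a real valued, countably additive set function on the ring of
bounded Borel subsets of `ℝ` that vanishes on points.  As for Mathlib's vector measures, the
function is defined on all sets, with the value `0` outside its domain, here the ring of bounded
Borel sets; so two b-measures are equal as soon as they agree on that ring. -/
structure BMeasure where
  /-- the underlying set function -/
  toFun : Set ℝ → ℝ
  junk' : ∀ A, ¬ IsBoundedBorel A → toFun A = 0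
  empty' : toFun ∅ = 0
  hasSum' : ∀ A : ℕ → Set ℝ, (∀ n, IsBoundedBorel (A n)) → Pairwise (Function.onFun Disjoint A) →
    IsBoundedBorel (⋃ n, A n) → HasSum (fun n => toFun (A n)) (toFun (⋃ n, A n))
  singleton' : ∀ t : ℝ, toFun {t} = 0

namespace BMeasure

instance : CoeFun BMeasure (fun _ => Set ℝ → ℝ) := ⟨BMeasure.toFun⟩

theorem toFun_injective : Function.Injective BMeasure.toFun := by
  rintro ⟨f, _, _, _, _⟩ ⟨g, _, _, _, _⟩ h
  simp only at h
  subst h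
  rfl

instance : Zero BMeasure :=
  ⟨{ toFun := 0
     junk' := fun _ _ => rfl
     empty' := rfl
     hasSum' := fun _ _ _ _ => hasSum_zero
     singleton' := fun _ => rfl }⟩

instance : Add BMeasure :=
  ⟨fun μ ν =>
    { toFun := μ.toFun + ν.toFun
      junk' := fun A hA => by simp [μ.junk' A hA, ν.junk' A hA]
      empty' := by simp [μ.empty', ν.empty']
      hasSum' := fun A h1 h2 h3 => (μ.hasSum' A h1 h2 h3).add (ν.hasSum' A h1 h2 h3)
      singleton' := fun t => by simp [μ.singleton' t, ν.singleton' t] }⟩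

instance : Neg BMeasure :=
  ⟨fun μ =>
    { toFun := -μ.toFun
      junk' := fun A hA => by simp [μ.junk' A hA]
      empty' := by simp [μ.empty']
      hasSum' := fun A h1 h2 h3 => (μ.hasSum' A h1 h2 h3).neg
      singleton' := fun t => by simp [μ.singleton' t] }⟩

instance : Sub BMeasure :=
  ⟨fun μ ν =>
    { toFun := μ.toFun - ν.toFun
      junk' := fun A hA => by simp [μ.junk' A hA, ν.junk' A hA]
      empty' := by simp [μ.empty', ν.empty']
      hasSum' := fun A h1 h2 h3 => (μ.hasSum' A h1 h2 h3).sub (ν.hasSum' A h1 h2 h3)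
      singleton' := fun t => by simp [μ.singleton' t, ν.singleton' t] }⟩

instance : SMul ℝ BMeasure :=
  ⟨fun c μ =>
    { toFun := c • μ.toFun
      junk' := fun A hA => by simp [μ.junk' A hA]
      empty' := by simp [μ.empty']
      hasSum' := fun A h1 h2 h3 => (μ.hasSum' A h1 h2 h3).mul_left c
      singleton' := fun t => by simp [μ.singleton' t] }⟩

instance : SMul ℕ BMeasure :=
  ⟨fun n μ =>
    { toFun := n • μ.toFun
      junk' := fun A hA => by simp [μ.junk' A hA]
      empty' := by simp [μ.empty']
      hasSum' := fun A h1 h2 h3 => (μ.hasSum' A h1 h2 h3).const_smul n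
      singleton' := fun t => by simp [μ.singleton' t] }⟩

instance : SMul ℤ BMeasure :=
  ⟨fun n μ =>
    { toFun := n • μ.toFun
      junk' := fun A hA => by simp [μ.junk' A hA]
      empty' := by simp [μ.empty']
      hasSum' := fun A h1 h2 h3 => (μ.hasSum' A h1 h2 h3).const_smul n
      singleton' := fun t => by simp [μ.singleton' t] }⟩

instance : AddCommGroup BMeasure :=
  Function.Injective.addCommGroup BMeasure.toFun toFun_injective rfl (fun _ _ => rfl)
    (fun _ => rfl) (fun _ _ => rfl) (fun _ _ => rfl) (fun _ _ => rfl)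

/-- The map that forgets that a set function is a b-measure, as an additive homomorphism. -/
def toFunHom : BMeasure →+ (Set ℝ → ℝ) where
  toFun := BMeasure.toFun
  map_zero' := rfl
  map_add' _ _ := rfl

/-- The vector space of b-measures, with the setwise operations. -/
instance : Module ℝ BMeasure :=
  Function.Injective.module ℝ toFunHom toFun_injective (fun _ _ => rfl)

/-- The translate `μ·t`, given by `(μ·t)(A) = μ(A + t)`. -/
def translate (μ : BMeasure) (t : ℝ) : BMeasure where
  toFun A := μ ((fun s => s + t) '' A)
  junk' A hA := by
    apply μ.junk'
    rintro ⟨h1, h2⟩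
    apply hA
    refine ⟨(MeasurableEquiv.addRight t).measurableSet_image.1 h1, ?_⟩
    have h := (isometry_add_right (-t)).lipschitz.isBounded_image h2
    rw [Set.image_image] at h
    have e : (fun x : ℝ => x + t + -t) '' A = A := by simp
    rwa [e] at h
  empty' := by simp [μ.empty']
  hasSum' A h1 h2 h3 := by
    have key : ∀ B : Set ℝ, IsBoundedBorel B → IsBoundedBorel ((fun s => s + t) '' B) := by
      intro B hB
      exact ⟨(MeasurableEquiv.addRight t).measurableSet_image.2 hB.1,
        (isometry_add_right t).lipschitz.isBounded_image hB.2⟩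
    rw [Set.image_iUnion]
    refine μ.hasSum' _ (fun n => key _ (h1 n)) ?_ ?_
    · intro m n hmn
      exact (Set.disjoint_image_iff (add_left_injective t)).2 (h2 hmn)
    · rw [← Set.image_iUnion]
      exact key _ h3
  singleton' s := by simp [μ.singleton']

/-- The total variation `|μ|(A)` of a b-measure on a bounded Borel set `A`: the supremum of
`∑ i, |μ (A i)|` over all finite Borel partitions of `A`. -/
noncomputable def totalVar (μ : BMeasure) (A : Set ℝ) : ℝ≥0∞ :=
  ⨆ (n : ℕ) (P : Fin n → Set ℝ) (_ : ∀ i, MeasurableSet (P i))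
    (_ : Pairwise (Function.onFun Disjoint P)) (_ : ⋃ i, P i = A),
    ∑ i, ENNReal.ofReal |μ (P i)|

theorem sum_le_totalVar (μ : BMeasure) {A : Set ℝ} {n : ℕ} (P : Fin n → Set ℝ)
    (h1 : ∀ i, MeasurableSet (P i)) (h2 : Pairwise (Function.onFun Disjoint P))
    (h3 : ⋃ i, P i = A) : ∑ i, ENNReal.ofReal |μ (P i)| ≤ μ.totalVar A := by
  unfold totalVar
  refine le_iSup_of_le n (le_iSup_of_le P ?_)
  exact le_iSup_of_le h1 (le_iSup_of_le h2 (le_iSup_of_le h3 le_rfl))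

theorem totalVar_le (μ : BMeasure) {A : Set ℝ} {C : ℝ≥0∞}
    (h : ∀ (n : ℕ) (P : Fin n → Set ℝ), (∀ i, MeasurableSet (P i)) →
      Pairwise (Function.onFun Disjoint P) → ⋃ i, P i = A →
      ∑ i, ENNReal.ofReal |μ (P i)| ≤ C) : μ.totalVar A ≤ C := by
  unfold totalVar
  exact iSup_le fun n => iSup_le fun P => iSup_le fun h1 => iSup_le fun h2 => iSup_le fun h3 =>
    h n P h1 h2 h3

theorem totalVar_zero (A : Set ℝ) : (0 : BMeasure).totalVar A = 0 := by
  refine le_antisymm (totalVar_le _ fun n P _ _ _ => ?_) zero_le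
  have : ∀ i, (0 : BMeasure) (P i) = 0 := fun i => rfl
  simp [this]

theorem totalVar_add_le (μ ν : BMeasure) (A : Set ℝ) :
    (μ + ν).totalVar A ≤ μ.totalVar A + ν.totalVar A := by
  refine totalVar_le _ fun n P h1 h2 h3 => ?_
  refine le_trans ?_ (add_le_add (μ.sum_le_totalVar P h1 h2 h3) (ν.sum_le_totalVar P h1 h2 h3))
  rw [← Finset.sum_add_distrib]
  refine Finset.sum_le_sum fun i _ => ?_
  rw [← ENNReal.ofReal_add (abs_nonneg _) (abs_nonneg _)]
  exact ENNReal.ofReal_le_ofReal (abs_add_le _ _)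

theorem totalVar_smul_le (c : ℝ) (μ : BMeasure) (A : Set ℝ) :
    (c • μ).totalVar A ≤ (‖c‖₊ : ℝ≥0∞) * μ.totalVar A := by
  refine totalVar_le _ fun n P h1 h2 h3 => ?_
  refine le_trans ?_ (mul_le_mul_right (μ.sum_le_totalVar P h1 h2 h3) _)
  rw [Finset.mul_sum]
  refine Finset.sum_le_sum fun i _ => ?_
  have h : (c • μ) (P i) = c * μ (P i) := rfl
  rw [h, abs_mul, ENNReal.ofReal_mul (abs_nonneg _), ← Real.norm_eq_abs c,
    ofReal_norm, enorm_eq_nnnorm]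

theorem totalVar_translate_le (μ : BMeasure) (t : ℝ) (A : Set ℝ) :
    (μ.translate t).totalVar A ≤ μ.totalVar ((fun s => s + t) '' A) := by
  refine totalVar_le _ fun n P h1 h2 h3 => ?_
  refine μ.sum_le_totalVar (fun i => (fun s => s + t) '' P i)
    (fun i => (MeasurableEquiv.addRight t).measurableSet_image.2 (h1 i)) ?_ ?_
  · intro i k hik
    exact (Set.disjoint_image_iff (add_left_injective t)).2 (h2 hik)
  · rw [← Set.image_iUnion, h3]

end BMeasure

/-- The class `𝓜_c⁺` of locally finite regular positive Borel measures on `ℝ` without purely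
discontinuous part, that is, without atoms. -/
def IsContMeasure (m : MeasureTheory.Measure ℝ) : Prop :=
  MeasureTheory.IsLocallyFiniteMeasure m ∧ m.Regular ∧ MeasureTheory.NullSingletonClass m

theorem isContMeasure_zero : IsContMeasure 0 :=
  ⟨inferInstance, inferInstance, ⟨fun _ => by simp⟩⟩

theorem IsContMeasure.add {m m' : MeasureTheory.Measure ℝ} (h : IsContMeasure m)
    (h' : IsContMeasure m') : IsContMeasure (m + m') := by
  obtain ⟨h1, -, h3⟩ := h
  obtain ⟨h1', -, h3'⟩ := h'
  have : MeasureTheory.IsLocallyFiniteMeasure (m + m') := by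
    refine ⟨fun x => ?_⟩
    obtain ⟨s, hs, hs'⟩ := m.finiteAt_nhds x
    obtain ⟨u, hu, hu'⟩ := m'.finiteAt_nhds x
    refine ⟨s ∩ u, Filter.inter_mem hs hu, ?_⟩
    rw [MeasureTheory.Measure.add_apply]
    exact ENNReal.add_lt_top.2
      ⟨(MeasureTheory.measure_mono Set.inter_subset_left).trans_lt hs',
        (MeasureTheory.measure_mono Set.inter_subset_right).trans_lt hu'⟩
  exact ⟨this, inferInstance, ⟨fun x => by simp [h3.measure_singleton x, h3'.measure_singleton x]⟩⟩

theorem IsContMeasure.smul {m : MeasureTheory.Measure ℝ} (h : IsContMeasure m) (c : ℝ≥0) :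
    IsContMeasure (c • m) := by
  obtain ⟨h1, -, h3⟩ := h
  have : MeasureTheory.IsLocallyFiniteMeasure (c • m) := inferInstance
  exact ⟨this, inferInstance, ⟨fun x => by simp [h3.measure_singleton x]⟩⟩

theorem IsContMeasure.map_sub {m : MeasureTheory.Measure ℝ} (h : IsContMeasure m) (t : ℝ) :
    IsContMeasure (m.map (fun s => s - t)) := by
  obtain ⟨h1, h2, h3⟩ := h
  have hr : (m.map (fun s => s - t)).Regular :=
    MeasureTheory.Measure.Regular.map (Homeomorph.subRight t)
  refine ⟨inferInstance, hr, ⟨fun x => ?_⟩⟩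
  rw [MeasureTheory.Measure.map_apply (by fun_prop) (measurableSet_singleton x)]
  have : (fun s : ℝ => s - t) ⁻¹' {x} = {x + t} := by
    ext s
    simp [sub_eq_iff_eq_add]
  rw [this]
  exact h3.measure_singleton _

/-- A non-decreasing family of moduli of continuity `ω_j : [0, ∞) → [0, ∞)`, `j ≥ 1`. -/
structure IsModuliFamily (ω : ℕ+ → ℝ≥0 → ℝ≥0) : Prop where
  continuous : ∀ j, Continuous (ω j)
  monotone : ∀ j, Monotone (ω j)
  zero : ∀ j, ω j 0 = 0
  le_succ : ∀ j r, ω j r ≤ ω (j + 1) r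

section Bounds

variable {N : ℕ}

/-- `m` is an `m`-bound on the closed ball `B_j` of the family `(ν_y)` of b-measures. -/
def IsMBound (ν : EuclideanSpace ℝ (Fin N) → BMeasure) (j : ℕ+)
    (m : MeasureTheory.Measure ℝ) : Prop :=
  IsContMeasure m ∧ ∀ A, IsBoundedBorel A → ∀ y, ‖y‖ ≤ (j : ℝ) → (ν y).totalVar A ≤ m A

/-- `l` is an `l`-bound on the closed ball `B_j` of the family `(ν_y)` of b-measures, with respect
to the moduli of continuity `ω`. -/
def IsLBound (ω : ℕ+ → ℝ≥0 → ℝ≥0) (ν : EuclideanSpace ℝ (Fin N) → BMeasure) (j : ℕ+)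
    (l : MeasureTheory.Measure ℝ) : Prop :=
  IsContMeasure l ∧ ∀ A, IsBoundedBorel A → ∀ y₁ y₂, ‖y₁‖ ≤ (j : ℝ) → ‖y₂‖ ≤ (j : ℝ) →
    (ν y₁ - ν y₂).totalVar A ≤ l A * (ω j ‖y₁ - y₂‖₊ : ℝ≥0∞)

end Bounds

/-- The vector space `𝔐_p` of parametric b-measures on `ℝ^N` with respect to the family of moduli
of continuity `ω`: the maps from `ℝ^N` to the b-measures that have an `m`-bound and an `l`-bound on
each closed ball `B_j`, `j ≥ 1`. -/
def ParamBMeasure (N : ℕ) (ω : ℕ+ → ℝ≥0 → ℝ≥0) :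
    Submodule ℝ (EuclideanSpace ℝ (Fin N) → BMeasure) where
  carrier := {ν | ∀ j, (∃ m, IsMBound ν j m) ∧ ∃ l, IsLBound ω ν j l}
  zero_mem' j := by
    refine ⟨⟨0, isContMeasure_zero, fun A _ y _ => ?_⟩,
      ⟨0, isContMeasure_zero, fun A _ y₁ y₂ _ _ => ?_⟩⟩
    · simp [BMeasure.totalVar_zero]
    · simp [BMeasure.totalVar_zero]
  add_mem' {ν ν'} h h' j := by
    obtain ⟨⟨m, hm, hm'⟩, l, hl, hl'⟩ := h j
    obtain ⟨⟨p, hp, hp'⟩, q, hq, hq'⟩ := h' j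
    refine ⟨⟨m + p, hm.add hp, fun A hA y hy => ?_⟩, l + q, hl.add hq,
      fun A hA y₁ y₂ h₁ h₂ => ?_⟩
    · exact (BMeasure.totalVar_add_le _ _ _).trans (add_le_add (hm' A hA y hy) (hp' A hA y hy))
    · have e : (ν + ν') y₁ - (ν + ν') y₂ = (ν y₁ - ν y₂) + (ν' y₁ - ν' y₂) := by
        simp only [Pi.add_apply]
        abel
      rw [e, MeasureTheory.Measure.add_apply, add_mul]
      exact (BMeasure.totalVar_add_le _ _ _).trans
        (add_le_add (hl' A hA y₁ y₂ h₁ h₂) (hq' A hA y₁ y₂ h₁ h₂))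
  smul_mem' c ν h j := by
    obtain ⟨⟨m, hm, hm'⟩, l, hl, hl'⟩ := h j
    refine ⟨⟨‖c‖₊ • m, hm.smul _, fun A hA y hy => ?_⟩, ‖c‖₊ • l, hl.smul _,
      fun A hA y₁ y₂ h₁ h₂ => ?_⟩
    · refine (BMeasure.totalVar_smul_le c (ν y) A).trans ?_
      exact mul_le_mul_right (hm' A hA y hy) _
    · have e : (c • ν) y₁ - (c • ν) y₂ = c • (ν y₁ - ν y₂) := by
        simp [smul_sub]
      rw [e]
      refine (BMeasure.totalVar_smul_le c _ A).trans ?_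
      refine (mul_le_mul_right (hl' A hA y₁ y₂ h₁ h₂) _).trans (le_of_eq ?_)
      rw [← mul_assoc]
      rfl

section Spaces

variable {N : ℕ} {ω : ℕ+ → ℝ≥0 → ℝ≥0}

/-- The translate `ν·t` of a parametric b-measure, `(ν·t)_y = ν_y·t`. -/
def ParamBMeasure.translate (ν : ParamBMeasure N ω) (t : ℝ) : ParamBMeasure N ω :=
  ⟨fun y => (ν.1 y).translate t, by
    have key : ∀ A : Set ℝ, IsBoundedBorel A →
        IsBoundedBorel ((fun s => s + t) '' A) ∧ ∀ m : MeasureTheory.Measure ℝ,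
          m.map (fun s => s - t) A = m ((fun s => s + t) '' A) := by
      intro A hA
      refine ⟨⟨(MeasurableEquiv.addRight t).measurableSet_image.2 hA.1,
        (isometry_add_right t).lipschitz.isBounded_image hA.2⟩, fun m => ?_⟩
      rw [MeasureTheory.Measure.map_apply (by fun_prop) hA.1]
      congr 1
      ext s
      simp [sub_eq_add_neg]
    intro j
    obtain ⟨⟨m, hm, hm'⟩, l, hl, hl'⟩ := ν.2 j
    refine ⟨⟨_, hm.map_sub t, fun A hA y hy => ?_⟩, _, hl.map_sub t,
      fun A hA y₁ y₂ h₁ h₂ => ?_⟩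
    · rw [(key A hA).2]
      exact (BMeasure.totalVar_translate_le _ t A).trans (hm' _ (key A hA).1 y hy)
    · rw [(key A hA).2]
      exact (BMeasure.totalVar_translate_le (ν.1 y₁ - ν.1 y₂) t A).trans
        (hl' _ (key A hA).1 y₁ y₂ h₁ h₂)⟩

/-- The points `t 0 < t 1 < ⋯ < t n` and the tags `τ i ∈ [t i, t (i + 1)]`, `i < n`, form a tagged
`δ`-partition of `[a, b]`.  (The other values of `t` and `τ` play no role.) -/
structure IsTaggedPartition (a b δ : ℝ) (n : ℕ) (t τ : ℕ → ℝ) : Prop where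
  left : t 0 = a
  right : t n = b
  lt : ∀ i < n, t i < t (i + 1)
  tag : ∀ i < n, τ i ∈ Icc (t i) (t (i + 1))
  mesh : ∀ i < n, t (i + 1) - t i < δ

/-- `L` is the integral `∫_a^b dν_{y(s)}` of `ν` along the curve `y : [a, b] → ℝ^N`, that is, the
limit of the Riemann sums over tagged partitions.  Only the values of `y` on `[a, b]` matter. -/
def HasParamIntegral (ν : ParamBMeasure N ω) (a b : ℝ) (y : ℝ → EuclideanSpace ℝ (Fin N))
    (L : ℝ) : Prop :=
  ∀ ε > 0, ∃ δ > 0, ∀ (n : ℕ) (t τ : ℕ → ℝ), IsTaggedPartition a b δ n t τ →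
    |L - ∑ i ∈ Finset.range n, ν.1 (y (τ i)) (Icc (t i) (t (i + 1)))| < ε

open Classical in
/-- The integral `∫_a^b dν_{y(s)}`; it exists, and is unique, for every continuous `y` and `a < b`.
(If there is no such integral, the value is `0` by convention.) -/
noncomputable def paramIntegral (ν : ParamBMeasure N ω) (a b : ℝ)
    (y : ℝ → EuclideanSpace ℝ (Fin N)) : ℝ :=
  if h : ∃ L, HasParamIntegral ν a b y L then h.choose else 0

/-- A suitable set of moduli of continuity `θ_j^I`, `j ≥ 1`, `I = [q₁, q₂]` with rational
`q₁ < q₂`; here `θ j q₁ q₂` stands for `θ_j^I` (its values for `q₂ ≤ q₁` play no role). -/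
structure IsSuitable (θ : ℕ+ → ℚ → ℚ → ℝ≥0 → ℝ≥0) : Prop where
  continuous : ∀ j q₁ q₂, q₁ < q₂ → Continuous (θ j q₁ q₂)
  monotone : ∀ j q₁ q₂, q₁ < q₂ → Monotone (θ j q₁ q₂)
  zero : ∀ j q₁ q₂, q₁ < q₂ → θ j q₁ q₂ 0 = 0
  le : ∀ j k q₁ q₂ p₁ p₂, j ≤ k → q₁ < q₂ → p₁ < p₂ → p₁ ≤ q₁ → q₂ ≤ p₂ →
    ∀ r, θ j q₁ q₂ r ≤ θ k p₁ p₂ r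

/-- The set `𝓚_j^I`, `I = [q₁, q₂]`, of continuous curves `I → B_j` that admit `θ_j^I` as a modulus
of continuity.  Curves are represented by maps on `ℝ`, whose values outside `I` play no role. -/
def curveSet (N : ℕ) (θ : ℕ+ → ℚ → ℚ → ℝ≥0 → ℝ≥0) (j : ℕ+) (q₁ q₂ : ℚ) :
    Set (ℝ → EuclideanSpace ℝ (Fin N)) :=
  {y | ContinuousOn y (Icc (q₁ : ℝ) q₂) ∧ (∀ s ∈ Icc (q₁ : ℝ) q₂, ‖y s‖ ≤ (j : ℝ)) ∧
    ∀ s ∈ Icc (q₁ : ℝ) q₂, ∀ t ∈ Icc (q₁ : ℝ) q₂, ‖y s - y t‖₊ ≤ θ j q₁ q₂ ‖s - t‖₊}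

/-- The seminorm `p_{I,j}(ν) = sup_{y ∈ 𝓚_j^I} |∫_I dν_{y(s)}|`, `I = [q₁, q₂]`, as an extended
non-negative number (it is always finite). -/
noncomputable def seminormTheta (θ : ℕ+ → ℚ → ℚ → ℝ≥0 → ℝ≥0) (j : ℕ+) (q₁ q₂ : ℚ)
    (ν : ParamBMeasure N ω) : ℝ≥0∞ :=
  ⨆ y ∈ curveSet N θ j q₁ q₂, ENNReal.ofReal |paramIntegral ν q₁ q₂ y|

/-- The topology `σ_Θ`, generated by the seminorms `p_{I,j}`: the coarsest topology for which all
the balls of all these seminorms are open. -/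
def sigmaTheta (N : ℕ) (ω : ℕ+ → ℝ≥0 → ℝ≥0) (θ : ℕ+ → ℚ → ℚ → ℝ≥0 → ℝ≥0) :
    TopologicalSpace (ParamBMeasure N ω) :=
  TopologicalSpace.generateFrom
    {U | ∃ (j : ℕ+) (q₁ q₂ : ℚ) (ν : ParamBMeasure N ω) (r : ℝ), q₁ < q₂ ∧ 0 < r ∧
      U = {μ | seminormTheta θ j q₁ q₂ (μ - ν) < ENNReal.ofReal r}}

/-- The seminorm `p_{I,y}(ν) = |∫_I dν_y| = |ν_y(I)|`, `I = [q₁, q₂]`. -/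
def seminormD (y : EuclideanSpace ℝ (Fin N)) (q₁ q₂ : ℚ) (ν : ParamBMeasure N ω) : ℝ :=
  |ν.1 y (Icc (q₁ : ℝ) q₂)|

/-- The topology `σ_D`, generated by the seminorms `p_{I,y}` with `y ∈ D`. -/
def sigmaD (N : ℕ) (ω : ℕ+ → ℝ≥0 → ℝ≥0) (D : Set (EuclideanSpace ℝ (Fin N))) :
    TopologicalSpace (ParamBMeasure N ω) :=
  TopologicalSpace.generateFrom
    {U | ∃ y ∈ D, ∃ (q₁ q₂ : ℚ) (ν : ParamBMeasure N ω) (r : ℝ), q₁ < q₂ ∧ 0 < r ∧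
      U = {μ | seminormD y q₁ q₂ (μ - ν) < r}}

/-- A family of positive measures is bounded. -/
def BoundedMeasures {Γ : Type*} (μ : Γ → MeasureTheory.Measure ℝ) : Prop :=
  ∃ c : ℝ, 0 < c ∧ ∀ t : ℝ, ∀ α, μ α (Icc t (t + 1)) ≤ ENNReal.ofReal c

/-- A family of positive measures is equicontinuous. -/
def EquicontinuousMeasures {Γ : Type*} (μ : Γ → MeasureTheory.Measure ℝ) : Prop :=
  ∀ ε : ℝ, 0 < ε → ∃ δ : ℝ, 0 < δ ∧ ∀ s t : ℝ, 0 ≤ t - s → t - s < δ → ∀ α,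
    μ α (Icc s t) < ENNReal.ofReal ε

/-- The family `(ν_α)` of parametric b-measures has equicontinuous `m`-bounds. -/
def FamilyEquicontMBounds {Γ : Type*} (ν : Γ → ParamBMeasure N ω) : Prop :=
  ∃ m : ℕ+ → Γ → MeasureTheory.Measure ℝ,
    ∀ j, (∀ α, IsMBound (ν α).1 j (m j α)) ∧ EquicontinuousMeasures (m j)

/-- The family `(ν_α)` of parametric b-measures has bounded `l`-bounds. -/
def FamilyBoundedLBounds {Γ : Type*} (ν : Γ → ParamBMeasure N ω) : Prop :=
  ∃ l : ℕ+ → Γ → MeasureTheory.Measure ℝ,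
    ∀ j, (∀ α, IsLBound ω (ν α).1 j (l j α)) ∧ BoundedMeasures (l j)

/-- `ν` has equicontinuous `m`-bounds: the family of its translates does. -/
def HasEquicontMBounds (ν : ParamBMeasure N ω) : Prop :=
  FamilyEquicontMBounds (fun t : ℝ => ParamBMeasure.translate ν t)

/-- `ν` has bounded `l`-bounds: the family of its translates does. -/
def HasBoundedLBounds (ν : ParamBMeasure N ω) : Prop :=
  FamilyBoundedLBounds (fun t : ℝ => ParamBMeasure.translate ν t)

/-- The hull of `ν`: the closure of the set of its translates in the given topology of the space of
parametric b-measures. -/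
def hull [TopologicalSpace (ParamBMeasure N ω)] (ν : ParamBMeasure N ω) :
    Set (ParamBMeasure N ω) :=
  closure (range fun t : ℝ => ParamBMeasure.translate ν t)

end Spaces

/-!
Let `F_x` be the distribution function of `ν_x`. That the `F_x` of all translates, `x ∈ B_j`, have
a common modulus of continuity only involves the values `ν_x((a, b])`, so it passes from the orbit
of `ν₀` to its closure, where it takes over the role of the equicontinuous `m`-bounds. There the
seminorm of an interval is changed little by moving the end points of the interval, hence the
seminorm of a shifted interval is controlled by the seminorms of nearby rational intervals;
together with `κ·τ - ν = (κ - ν)·τ + (ν·τ - ν)` this gives the joint continuity of the flow.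

For the compactness it suffices, the topologies being regular, that every ultrafilter on the orbit
converges. Along an ultrafilter the distribution functions of `ν_x`, of the `m`-bounds and of the
`l`-bounds converge at every point. The first two limits are continuous, and the domination of one
by the other makes the limit of the `ν_x` a b-measure. The limit of the `l`-bounds may have atoms,
but its atomless part is still an `l`-bound of the limit, as b-measures do not charge points.
Finally, a curve in `𝓚_j^I` is uniformly close to a step function with values in a fixed finite
net, on a fixed partition; the boundedness of the `l`-bounds then turns convergence on intervals
into convergence of the seminorms of `σ_Θ`.
-/

/-! ### b-measures and their distribution functions -/

section BoundedBorel

theorem isBoundedBorel_Ioc (a b : ℝ) : IsBoundedBorel (Ioc a b) :=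
  ⟨measurableSet_Ioc, Metric.isBounded_Ioc a b⟩

theorem isBoundedBorel_Icc (a b : ℝ) : IsBoundedBorel (Icc a b) :=
  ⟨measurableSet_Icc, Metric.isBounded_Icc a b⟩

theorem IsBoundedBorel.subset {A B : Set ℝ} (hB : IsBoundedBorel B) (hA : MeasurableSet A)
    (h : A ⊆ B) : IsBoundedBorel A :=
  ⟨hA, hB.2.subset h⟩

theorem IsBoundedBorel.exists_subset_Ioc {A : Set ℝ} (hA : IsBoundedBorel A) :
    ∃ a b, A ⊆ Ioc a b := by
  obtain ⟨r, h⟩ := hA.2.subset_ball 0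
  refine ⟨-r, r, h.trans ?_⟩
  rw [Real.ball_eq_Ioo, zero_sub, zero_add]
  exact Ioo_subset_Ioc_self

end BoundedBorel

namespace BMeasure

open MeasureTheory Filter Topology

@[simp]
theorem add_apply (μ ν : BMeasure) (A : Set ℝ) : (μ + ν) A = μ A + ν A := rfl

@[simp]
theorem sub_apply (μ ν : BMeasure) (A : Set ℝ) : (μ - ν) A = μ A - ν A := rfl

open Classical in
/-- The restriction `A ↦ μ (A ∩ K)` of a b-measure to a bounded Borel set `K`, as a signed measure
on the Borel σ-algebra.  It makes the additivity results for signed measures available. -/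
noncomputable def restrict (μ : BMeasure) (K : Set ℝ) (hK : IsBoundedBorel K) :
    SignedMeasure ℝ where
  measureOf' A := if MeasurableSet A then μ (A ∩ K) else 0
  empty' := by simp [μ.empty']
  not_measurable' A hA := if_neg hA
  m_iUnion' A hA hd := by
    simp only [hA, MeasurableSet.iUnion hA, if_true, iUnion_inter]
    refine μ.hasSum' _ (fun n => hK.subset ((hA n).inter hK.1) inter_subset_right)
      (fun i j hij => (hd hij).mono inter_subset_left inter_subset_left) ?_
    rw [← iUnion_inter]
    exact hK.subset ((MeasurableSet.iUnion hA).inter hK.1) inter_subset_right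

theorem restrict_apply (μ : BMeasure) {A K : Set ℝ} (hK : IsBoundedBorel K)
    (hA : MeasurableSet A) : μ.restrict K hK A = μ (A ∩ K) :=
  if_pos hA

theorem apply_iUnion (μ : BMeasure) {ι : Type*} [Fintype ι] {A : ι → Set ℝ}
    (hA : ∀ i, MeasurableSet (A i)) (hd : Pairwise (Function.onFun Disjoint A))
    (hU : IsBoundedBorel (⋃ i, A i)) : μ (⋃ i, A i) = ∑ i, μ (A i) := by
  have h := (μ.restrict _ hU).of_disjoint_iUnion hA hd
  simpa only [tsum_fintype, restrict_apply, hA, hU.1, inter_self,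
    inter_eq_left.2 (subset_iUnion A _)] using h

theorem apply_union (μ : BMeasure) {A B : Set ℝ} (hA : IsBoundedBorel A) (hB : IsBoundedBorel B)
    (hd : Disjoint A B) : μ (A ∪ B) = μ A + μ B := by
  have hU : IsBoundedBorel (A ∪ B) := ⟨hA.1.union hB.1, hA.2.union hB.2⟩
  have h := (μ.restrict _ hU).of_union hd hA.1 hB.1
  simpa only [restrict_apply, hA.1, hB.1, hU.1, inter_self, union_inter_cancel_left,
    union_inter_cancel_right, inter_eq_left.2 subset_union_left,
    inter_eq_left.2 subset_union_right] using h

theorem apply_eq_zero_of_countable (μ : BMeasure) {A : Set ℝ} (hA : IsBoundedBorel A)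
    (hc : A.Countable) : μ A = 0 := by
  have := hc.to_subtype
  have h := (μ.restrict A hA).of_disjoint_iUnion (f := fun x : A => {(x : ℝ)})
    (fun _ => measurableSet_singleton _)
    fun x y hxy => disjoint_singleton.2 fun h => hxy (Subtype.ext h)
  have hx : ∀ x : A, μ ({(x : ℝ)} ∩ A) = 0 := fun x => by
    rw [singleton_inter_of_mem x.2, μ.singleton']
  simpa only [iUnion_of_singleton_coe, restrict_apply, hA.1, measurableSet_singleton, inter_self,
    hx, tsum_zero] using h

theorem apply_Icc (μ : BMeasure) {a b : ℝ} (hab : a ≤ b) : μ (Icc a b) = μ (Ioc a b) := by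
  rw [← Ioc_union_left hab, μ.apply_union (isBoundedBorel_Ioc a b)
    (by simpa using isBoundedBorel_Icc a a) (by simp), μ.singleton', add_zero]

/-- The distribution function of a b-measure, normalized to vanish at `0`. -/
def cdf (μ : BMeasure) (s : ℝ) : ℝ := μ (Ioc 0 s) - μ (Ioc s 0)

theorem cdf_zero (μ : BMeasure) : μ.cdf 0 = 0 := sub_self _

theorem cdf_sub (μ ν : BMeasure) (s : ℝ) : (μ - ν).cdf s = μ.cdf s - ν.cdf s := by
  simp only [cdf, sub_apply]
  ring

theorem apply_Ioc_add (μ : BMeasure) {a b c : ℝ} (hab : a ≤ b) (hbc : b ≤ c) :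
    μ (Ioc a b) + μ (Ioc b c) = μ (Ioc a c) := by
  rw [← μ.apply_union (isBoundedBorel_Ioc a b) (isBoundedBorel_Ioc b c)
    (Ioc_disjoint_Ioc_of_le le_rfl), Ioc_union_Ioc_eq_Ioc hab hbc]

theorem apply_Ioc (μ : BMeasure) {a b : ℝ} (hab : a ≤ b) :
    μ (Ioc a b) = μ.cdf b - μ.cdf a := by
  unfold cdf
  rcases le_total 0 a with ha | ha
  · rw [← μ.apply_Ioc_add ha hab, Ioc_eq_empty_of_le ha, Ioc_eq_empty_of_le (ha.trans hab)]
    ring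
  rcases le_total 0 b with hb | hb
  · rw [← μ.apply_Ioc_add ha hb, Ioc_eq_empty_of_le ha, Ioc_eq_empty_of_le hb, μ.empty']
    ring
  · rw [← μ.apply_Ioc_add hab hb, Ioc_eq_empty_of_le hb, Ioc_eq_empty_of_le (hab.trans hb)]
    ring

theorem translate_Ioc (μ : BMeasure) (t a b : ℝ) :
    μ.translate t (Ioc a b) = μ (Ioc (a + t) (b + t)) := by
  change μ ((fun s => s + t) '' Ioc a b) = _
  rw [image_add_const_Ioc]

theorem translate_zero (μ : BMeasure) : μ.translate 0 = μ :=
  toFun_injective (funext fun A => by simp [translate])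

theorem translate_translate (μ : BMeasure) (s t : ℝ) :
    (μ.translate s).translate t = μ.translate (s + t) :=
  toFun_injective (funext fun A => congrArg μ.toFun (by
    simp only [image_image, add_assoc, add_comm t]))

theorem abs_cdf_sub (μ : BMeasure) (s t : ℝ) : |μ.cdf t - μ.cdf s| = |μ (uIoc s t)| := by
  rcases le_total s t with hst | hts
  · rw [uIoc_of_le hst, μ.apply_Ioc hst]
  · rw [uIoc_of_ge hts, μ.apply_Ioc hts, abs_sub_comm]

/-- The total variation of a signed measure does not charge the points that the signed measure does
not charge, so the variation of short intervals around `b` tends to `0`. -/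
theorem continuous_cdf (μ : BMeasure) : Continuous μ.cdf := by
  refine continuous_iff_continuousAt.2 fun b => tendsto_iff_dist_tendsto_zero.2 ?_
  let v := μ.restrict _ (isBoundedBorel_Icc (b - 1) (b + 1))
  have hIcc : Tendsto (fun u => v.totalVariation.real (Icc (b - |u - b|) (b + |u - b|)))
      (𝓝 b) (𝓝 0) := by
    have hv : NullSingletonClass v.totalVariation := ⟨fun x => by
      rw [SignedMeasure.totalVariation_eq_variation,
        VectorMeasure.variation_apply_eq_zero (measurableSet_singleton x)]
      intro t htx ht
      rw [restrict_apply _ _ ht]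
      exact μ.apply_eq_zero_of_countable
        ((isBoundedBorel_Icc _ _).subset (ht.inter measurableSet_Icc) inter_subset_right)
        ((countable_singleton x).mono (inter_subset_left.trans htx))⟩
    have habs : Tendsto (fun u : ℝ => |u - b|) (𝓝 b) (𝓝 0) := by
      simpa only [id, Real.dist_eq] using tendsto_iff_dist_tendsto_zero.1 (tendsto_id (x := 𝓝 b))
    exact (ENNReal.tendsto_toReal ENNReal.zero_ne_top).comp ((tendsto_measure_Icc _ b).comp habs)
  refine squeeze_zero' (Eventually.of_forall fun _ => dist_nonneg) ?_ hIcc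
  filter_upwards [Metric.ball_mem_nhds b one_pos] with u hu
  have hsub : uIoc b u ⊆ Icc (b - |u - b|) (b + |u - b|) := fun s hs => by
    rw [← Real.closedBall_eq_Icc]
    exact abs_sub_left_of_mem_uIcc (uIoc_subset_uIcc hs)
  have hsub1 : uIoc b u ⊆ Icc (b - 1) (b + 1) := hsub.trans
    (Icc_subset_Icc (sub_le_sub_left (le_of_lt hu) b) (add_le_add_right (le_of_lt hu) b))
  calc dist (μ.cdf u) (μ.cdf b) = |v (uIoc b u)| := by
        rw [Real.dist_eq, abs_cdf_sub, restrict_apply _ _ measurableSet_uIoc,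
          inter_eq_left.2 hsub1]
    _ ≤ v.totalVariation.real (uIoc b u) := v.norm_le_totalVariation _
    _ ≤ _ := measureReal_mono hsub

/-- `μ.OscLE δ ε` says that `ε` bounds the oscillation of the distribution function of `μ` at scale
`δ`.  For a family of b-measures, equicontinuity of `m`-bounds enters only through such bounds. -/
def OscLE (μ : BMeasure) (δ ε : ℝ) : Prop :=
  ∀ s t, |s - t| < δ → |μ.cdf s - μ.cdf t| ≤ ε

theorem oscLE_of_apply_Ioc {μ : BMeasure} {δ ε : ℝ}
    (h : ∀ s t, s ≤ t → t - s < δ → |μ (Ioc s t)| ≤ ε) : μ.OscLE δ ε := by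
  intro s t hst
  rcases le_total s t with hs | hs
  · rw [abs_sub_comm, ← μ.apply_Ioc hs]
    exact h s t hs ((neg_sub s t ▸ neg_le_abs _).trans_lt hst)
  · rw [← μ.apply_Ioc hs]
    exact h t s hs ((le_abs_self _).trans_lt hst)

theorem oscLE_of_apply_Ioc_rat {μ : BMeasure} {δ ε : ℝ} (hε : 0 ≤ ε)
    (h : ∀ p q : ℚ, p < q → (q : ℝ) - p < δ → |μ (Ioc (p : ℝ) q)| ≤ ε) : μ.OscLE δ ε := by
  refine oscLE_of_apply_Ioc fun s t hst hδ => ?_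
  obtain rfl | hst := hst.eq_or_lt
  · simpa [μ.empty'] using hε
  have hcdf := μ.continuous_cdf
  have hclosed : IsClosed {x : ℝ × ℝ | |μ.cdf x.2 - μ.cdf x.1| ≤ ε} :=
    isClosed_le (by fun_prop) continuous_const
  have hopen : IsOpen {x : ℝ × ℝ | x.1 < x.2 ∧ x.2 - x.1 < δ} :=
    (isOpen_lt continuous_fst continuous_snd).inter
      (isOpen_lt (continuous_snd.sub continuous_fst) continuous_const)
  have hdense := (Rat.denseRange_cast (𝕜 := ℝ)).prodMap (Rat.denseRange_cast (𝕜 := ℝ))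
  rw [μ.apply_Ioc hst.le]
  refine closure_minimal ?_ hclosed
    (hdense.open_subset_closure_inter hopen (show (s, t) ∈ _ from ⟨hst, hδ⟩))
  rintro _ ⟨⟨hpq, hpqδ⟩, ⟨p, q⟩, rfl⟩
  change |μ.cdf q - μ.cdf p| ≤ ε
  have hpq' : (p : ℝ) < q := hpq
  rw [← μ.apply_Ioc hpq'.le]
  exact h p q (Rat.cast_lt.1 hpq') hpqδ

theorem OscLE.sub {μ ν : BMeasure} {δ ε ε' : ℝ} (hμ : μ.OscLE δ ε) (hν : ν.OscLE δ ε') :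
    (μ - ν).OscLE δ (ε + ε') := fun s t hst => by
  rw [cdf_sub, cdf_sub, sub_sub_sub_comm]
  exact (abs_sub _ _).trans (add_le_add (hμ s t hst) (hν s t hst))

theorem OscLE.abs_apply_Ioc_sub_le {μ : BMeasure} {δ ε : ℝ} (h : μ.OscLE δ ε) {a b c d : ℝ}
    (hab : a ≤ b) (hcd : c ≤ d) (hac : |a - c| < δ) (hbd : |b - d| < δ) :
    |μ (Ioc a b) - μ (Ioc c d)| ≤ 2 * ε := by
  rw [μ.apply_Ioc hab, μ.apply_Ioc hcd, sub_sub_sub_comm, two_mul]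
  exact (abs_sub _ _).trans (add_le_add (h _ _ hbd) (h _ _ hac))

theorem ofReal_abs_le_totalVar (μ : BMeasure) {A : Set ℝ} (hA : MeasurableSet A) :
    ENNReal.ofReal |μ A| ≤ μ.totalVar A := by
  simpa using μ.sum_le_totalVar (n := 1) (fun _ => A) (fun _ => hA)
    (fun i j hij => absurd (Subsingleton.elim i j) hij) (iUnion_const A)

theorem totalVar_le_measure (μ : BMeasure) {m : Measure ℝ}
    (h : ∀ A, IsBoundedBorel A → ENNReal.ofReal |μ A| ≤ m A) {A : Set ℝ}
    (hA : IsBoundedBorel A) : μ.totalVar A ≤ m A := by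
  refine μ.totalVar_le fun n P hP hd hU => ?_
  calc ∑ i, ENNReal.ofReal |μ (P i)| ≤ ∑ i, m (P i) :=
        Finset.sum_le_sum fun i _ => h _ (hA.subset (hP i) (hU ▸ subset_iUnion P i))
    _ = m A := by rw [← hU, measure_iUnion hd hP, tsum_fintype]

end BMeasure

/-! ### Comparison with Stieltjes measures -/

section Stieltjes

open MeasureTheory

theorem hasSum_measureReal_iUnion {α : Type*} [MeasurableSpace α] {m : Measure α} {A : ℕ → Set α}
    (hA : ∀ n, MeasurableSet (A n)) (hd : Pairwise (Function.onFun Disjoint A))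
    (hU : m (⋃ n, A n) ≠ ⊤) : HasSum (fun n => m.real (A n)) (m.real (⋃ n, A n)) := by
  rw [measure_iUnion hd hA] at hU
  rw [Measure.real, measure_iUnion hd hA, ENNReal.tsum_toReal_eq (ENNReal.ne_top_of_tsum_ne_top hU)]
  exact ENNReal.hasSum_toReal hU

theorem isContMeasure_stieltjes (f : StieltjesFunction ℝ) (hf : Continuous f) :
    IsContMeasure f.measure :=
  ⟨inferInstance, inferInstance, ⟨fun x => by
    simp [StieltjesFunction.measure_singleton, hf.continuousWithinAt.leftLim_eq]⟩⟩

theorem measureReal_stieltjes_Ioc (f : StieltjesFunction ℝ) {a b : ℝ} (hab : a ≤ b) :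
    f.measure.real (Ioc a b) = f b - f a := by
  rw [Measure.real, StieltjesFunction.measure_Ioc,
    ENNReal.toReal_ofReal (sub_nonneg.2 (f.mono hab))]

/-- The part of a measure without atoms. -/
noncomputable def atomlessPart (m : Measure ℝ) : Measure ℝ :=
  m.restrict {x | m {x} = 0}

theorem isContMeasure_atomlessPart (m : Measure ℝ) [IsLocallyFiniteMeasure m] :
    IsContMeasure (atomlessPart m) := by
  have : IsLocallyFiniteMeasure (atomlessPart m) :=
    ⟨fun x => (m.finiteAt_nhds x).imp fun s hs =>
      ⟨hs.1, (Measure.restrict_apply_le _ _).trans_lt hs.2⟩⟩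
  refine ⟨this, inferInstance, ⟨fun x => ?_⟩⟩
  rw [atomlessPart, Measure.restrict_apply (measurableSet_singleton x)]
  by_cases hx : m {x} = 0
  · exact measure_mono_null inter_subset_left hx
  · have hx' : x ∉ {x | m {x} = 0} := hx
    rw [singleton_inter_eq_empty.2 hx', measure_empty]

end Stieltjes

namespace BMeasure

open MeasureTheory

theorem totalVar_le_atomlessPart (μ : BMeasure) {m : Measure ℝ} [SFinite m]
    (h : ∀ A, IsBoundedBorel A → μ.totalVar A ≤ m A) {A : Set ℝ} (hA : IsBoundedBorel A) :
    μ.totalVar A ≤ atomlessPart m A := by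
  have hc : {x | m {x} = 0}ᶜ.Countable := by
    simpa only [compl_ofPred, pos_iff_ne_zero] using
      Measure.countable_meas_pos_of_disjoint_iUnion (μ := m)
        (fun x : ℝ => measurableSet_singleton x) (fun x y hxy => disjoint_singleton.2 hxy)
  have hS : MeasurableSet {x | m {x} = 0} := hc.measurableSet.of_compl
  refine μ.totalVar_le_measure (fun B hB => ?_) hA
  have hB' : μ B = μ (B ∩ {x | m {x} = 0}) := by
    conv_lhs => rw [← inter_union_compl B {x | m {x} = 0}]
    rw [μ.apply_union (hB.subset (hB.1.inter hS) inter_subset_left)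
      (hB.subset (hB.1.inter hS.compl) inter_subset_left)
      (disjoint_compl_right.mono inter_subset_right inter_subset_right),
      μ.apply_eq_zero_of_countable (hB.subset (hB.1.inter hS.compl) inter_subset_left)
        (hc.mono inter_subset_right), add_zero]
  rw [hB', atomlessPart, Measure.restrict_apply hB.1]
  exact (μ.ofReal_abs_le_totalVar (hB.1.inter hS)).trans
    (h _ (hB.subset (hB.1.inter hS) inter_subset_left))

open Classical in
/-- The b-measure given by a locally finite measure without atoms. -/
noncomputable def ofMeasure (m : Measure ℝ) (hm : IsContMeasure m) : BMeasure where
  toFun A := if IsBoundedBorel A then m.real A else 0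
  junk' A hA := if_neg hA
  empty' := by simp
  hasSum' A hA hd hU := by
    have := hm.1
    simp only [hA, hU, if_true]
    exact hasSum_measureReal_iUnion (fun n => (hA n).1) hd hU.2.measure_lt_top.ne
  singleton' t := by simp [Measure.real, hm.2.2.measure_singleton t]

theorem ofMeasure_apply {m : Measure ℝ} (hm : IsContMeasure m) {A : Set ℝ}
    (hA : IsBoundedBorel A) : ofMeasure m hm A = m.real A :=
  if_pos hA

theorem cdf_ofMeasure_sub {m : Measure ℝ} (hm : IsContMeasure m) {s t : ℝ} (hst : s ≤ t) :
    (ofMeasure m hm).cdf t - (ofMeasure m hm).cdf s = m.real (Ioc s t) := by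
  rw [← apply_Ioc _ hst, ofMeasure_apply hm (isBoundedBorel_Ioc s t)]

theorem monotone_cdf_ofMeasure {m : Measure ℝ} (hm : IsContMeasure m) :
    Monotone (ofMeasure m hm).cdf := fun s t hst => by
  rw [← sub_nonneg, cdf_ofMeasure_sub hm hst]
  exact measureReal_nonneg

theorem oscLE_ofMeasure {m : Measure ℝ} (hm : IsContMeasure m) {δ ε : ℝ} (hε : 0 ≤ ε)
    (h : ∀ s t, s ≤ t → t - s < δ → m (Icc s t) ≤ ENNReal.ofReal ε) :
    (ofMeasure m hm).OscLE δ ε := oscLE_of_apply_Ioc fun s t hst hlt => by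
  rw [ofMeasure_apply hm (isBoundedBorel_Ioc s t), abs_of_nonneg measureReal_nonneg]
  exact ENNReal.toReal_le_of_le_ofReal hε
    ((measure_mono Ioc_subset_Icc_self).trans (h s t hst hlt))

theorem apply_eq_sub_measureReal (μ : BMeasure) (f g : StieltjesFunction ℝ)
    (h : ∀ s t, s ≤ t → μ (Ioc s t) = (f t - f s) - (g t - g s)) {A : Set ℝ}
    (hA : IsBoundedBorel A) : μ A = f.measure.real A - g.measure.real A := by
  obtain ⟨a, b, hAab⟩ := hA.exists_subset_Ioc
  have hIoc : ∀ s t, μ (Ioc s t) = f.measure.real (Ioc s t) - g.measure.real (Ioc s t) := by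
    intro s t
    rcases le_total s t with hst | hts
    · rw [h s t hst, measureReal_stieltjes_Ioc f hst, measureReal_stieltjes_Ioc g hst]
    · simp [Ioc_eq_empty_of_le hts, μ.empty']
  have hK := isBoundedBorel_Ioc a b
  have (k : StieltjesFunction ℝ) : IsFiniteMeasure (k.measure.restrict (Ioc a b)) :=
    isFiniteMeasure_restrict.2 hK.2.measure_lt_top.ne
  have key : μ.restrict (Ioc a b) hK = (f.measure.restrict (Ioc a b)).toSignedMeasure -
      (g.measure.restrict (Ioc a b)).toSignedMeasure := by
    refine VectorMeasure.ext_of_generateFrom _ ?_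
      ((BorelSpace.measurable_eq (α := ℝ)).trans (borel_eq_generateFrom_Ioc ℝ))
      (isPiSystem_Ioc id id) ?_
    · rintro _ ⟨s, t, -, rfl⟩
      simp only [FunLike.coe_sub, Pi.sub_apply, restrict_apply, measurableSet_Ioc,
        Measure.toSignedMeasure_apply_measurable, measureReal_restrict_apply, Ioc_inter_Ioc, hIoc]
    · simp only [FunLike.coe_sub, Pi.sub_apply, restrict_apply, MeasurableSet.univ,
        Measure.toSignedMeasure_apply_measurable, measureReal_restrict_apply, univ_inter, hIoc]
  have := congrArg (fun ρ : SignedMeasure ℝ => ρ A) key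
  simpa only [FunLike.coe_sub, Pi.sub_apply, restrict_apply, hA.1,
    Measure.toSignedMeasure_apply_measurable, measureReal_restrict_apply,
    inter_eq_left.2 hAab] using this

theorem apply_le_measureReal (μ : BMeasure) (k : StieltjesFunction ℝ)
    (h : ∀ s t, s ≤ t → μ (Ioc s t) ≤ k t - k s) {A : Set ℝ} (hA : IsBoundedBorel A) :
    μ A ≤ k.measure.real A := by
  let g : StieltjesFunction ℝ :=
    { toFun := fun t => k t - μ.cdf t
      mono' := fun s t hst => by linarith [h s t hst, μ.apply_Ioc hst]
      right_continuous' := fun s =>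
        (k.right_continuous s).sub μ.continuous_cdf.continuousWithinAt }
  have hg := μ.apply_eq_sub_measureReal k g (fun s t hst => by
    rw [μ.apply_Ioc hst]
    change _ = (k t - k s) - ((k t - μ.cdf t) - (k s - μ.cdf s))
    ring) hA
  linarith [measureReal_nonneg (μ := g.measure) (s := A)]

theorem totalVar_le_stieltjes (μ : BMeasure) (k : StieltjesFunction ℝ)
    (h : ∀ s t, s ≤ t → |μ (Ioc s t)| ≤ k t - k s) {A : Set ℝ} (hA : IsBoundedBorel A) :
    μ.totalVar A ≤ k.measure A := by
  refine μ.totalVar_le_measure (fun B hB => ?_) hA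
  refine (ENNReal.ofReal_le_iff_le_toReal hB.2.measure_lt_top.ne).2 (abs_le'.2 ⟨?_, ?_⟩)
  · exact μ.apply_le_measureReal k (fun s t hst => (le_abs_self _).trans (h s t hst)) hB
  · exact (-μ).apply_le_measureReal k (fun s t hst => (neg_le_abs _).trans (h s t hst)) hB

/-- The b-measure is the difference of the Stieltjes measures of `G + k` and `k`. -/
theorem exists_apply_Ioc_eq (G : ℝ → ℝ) (k : StieltjesFunction ℝ) (hk : Continuous k)
    (h : ∀ s t, s ≤ t → |G t - G s| ≤ k t - k s) :
    ∃ μ : BMeasure, ∀ s t, s ≤ t → μ (Ioc s t) = G t - G s := by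
  have hG : Continuous G := by
    refine continuous_iff_continuousAt.2 fun s => tendsto_iff_dist_tendsto_zero.2 ?_
    refine squeeze_zero (fun _ => dist_nonneg) (g := fun t => |k t - k s|) (fun t => ?_) ?_
    · rcases le_total s t with hst | hts
      · exact (h s t hst).trans (le_abs_self _)
      · rw [Real.dist_eq, abs_sub_comm, abs_sub_comm (k t)]
        exact (h t s hts).trans (le_abs_self _)
    · exact tendsto_iff_dist_tendsto_zero.1 (hk.tendsto s)
  let f : StieltjesFunction ℝ :=
    { toFun := fun t => G t + k t
      mono' := fun s t hst => by linarith [(abs_le.1 (h s t hst)).1]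
      right_continuous' := fun s => (hG.add hk).continuousWithinAt }
  refine ⟨ofMeasure f.measure (isContMeasure_stieltjes f (hG.add hk)) -
    ofMeasure k.measure (isContMeasure_stieltjes k hk), fun s t hst => ?_⟩
  rw [sub_apply, ofMeasure_apply _ (isBoundedBorel_Ioc s t), ofMeasure_apply _
    (isBoundedBorel_Ioc s t), measureReal_stieltjes_Ioc f hst, measureReal_stieltjes_Ioc k hst]
  change (G t + k t - (G s + k s)) - _ = _
  ring

end BMeasure

/-! ### Partitions and Riemann sums -/

/-- The sets `A i` form a Borel partition of `K`. -/
structure IsBorelPartition {ι : Type*} (K : Set ℝ) (A : ι → Set ℝ) : Prop where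
  measurableSet : ∀ i, MeasurableSet (A i)
  disjoint : Pairwise (Function.onFun Disjoint A)
  iUnion : ⋃ i, A i = K

namespace IsBorelPartition

open MeasureTheory

variable {ι κ : Type*} {K K' : Set ℝ} {A : ι → Set ℝ} {B : κ → Set ℝ}

theorem subset (hA : IsBorelPartition K A) (i : ι) : A i ⊆ K :=
  hA.iUnion ▸ subset_iUnion A i

theorem isBoundedBorel (hA : IsBorelPartition K A) (hK : IsBoundedBorel K) (i : ι) :
    IsBoundedBorel (A i) :=
  hK.subset (hA.measurableSet i) (hA.subset i)

theorem inter (hB : IsBorelPartition K B) {S : Set ℝ} (hS : MeasurableSet S) (hSK : S ⊆ K) :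
    IsBorelPartition S (fun k => S ∩ B k) where
  measurableSet k := hS.inter (hB.measurableSet k)
  disjoint _ _ h := (hB.disjoint h).mono inter_subset_right inter_subset_right
  iUnion := by rw [← inter_iUnion, hB.iUnion, inter_eq_left.2 hSK]

theorem sumElim (hA : IsBorelPartition K A) (hB : IsBorelPartition K' B) (hd : Disjoint K K') :
    IsBorelPartition (K ∪ K') (Sum.elim A B) where
  measurableSet := Sum.rec hA.measurableSet hB.measurableSet
  disjoint := by
    rintro (i | k) (i' | k') h
    · exact hA.disjoint fun e => h (congrArg Sum.inl e)
    · exact hd.mono (hA.subset i) (hB.subset k')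
    · exact (hd.mono (hA.subset i') (hB.subset k)).symm
    · exact hB.disjoint fun e => h (congrArg Sum.inr e)
  iUnion := by
    rw [iUnion_sum]
    exact congrArg₂ _ hA.iUnion hB.iUnion

theorem sum_apply [Fintype ι] (hA : IsBorelPartition K A) (hK : IsBoundedBorel K) (μ : BMeasure) :
    ∑ i, μ (A i) = μ K := by
  rw [← μ.apply_iUnion hA.measurableSet hA.disjoint (hA.iUnion.symm ▸ hK), hA.iUnion]

theorem sum_measureReal [Fintype ι] (hA : IsBorelPartition K A) (hK : IsBoundedBorel K)
    (l : Measure ℝ) [IsLocallyFiniteMeasure l] : ∑ i, l.real (A i) = l.real K := by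
  rw [← measureReal_iUnion_fintype hA.disjoint hA.measurableSet
    (fun i => (hA.isBoundedBorel hK i).2.measure_lt_top.ne), hA.iUnion]

theorem abs_sum_sub_sum_le [Fintype ι] [Fintype κ] (hA : IsBorelPartition K A)
    (hB : IsBorelPartition K B) (hK : IsBoundedBorel K) (μ : ι → BMeasure) (ρ : κ → BMeasure)
    (l : Measure ℝ) [IsLocallyFiniteMeasure l] (c : ℝ)
    (h : ∀ i k, (A i ∩ B k).Nonempty →
      |μ i (A i ∩ B k) - ρ k (A i ∩ B k)| ≤ l.real (A i ∩ B k) * c) :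
    |∑ i, μ i (A i) - ∑ k, ρ k (B k)| ≤ l.real K * c := by
  have hAB (i : ι) : IsBorelPartition (A i) fun k => A i ∩ B k :=
    hB.inter (hA.measurableSet i) (hA.subset i)
  have hBA (k : κ) : IsBorelPartition (B k) fun i => A i ∩ B k := by
    simpa only [inter_comm] using hA.inter (hB.measurableSet k) (hB.subset k)
  have hμ : ∑ i, μ i (A i) = ∑ i, ∑ k, μ i (A i ∩ B k) := Finset.sum_congr rfl fun i _ =>
    ((hAB i).sum_apply (hA.isBoundedBorel hK i) _).symm
  have hρ : ∑ k, ρ k (B k) = ∑ i, ∑ k, ρ k (A i ∩ B k) := by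
    rw [Finset.sum_comm]
    exact Finset.sum_congr rfl fun k _ => ((hBA k).sum_apply (hB.isBoundedBorel hK k) _).symm
  have hl : ∑ i, ∑ k, l.real (A i ∩ B k) * c = l.real K * c := by
    simp only [← Finset.sum_mul, ← hA.sum_measureReal hK l,
      (hAB _).sum_measureReal (hA.isBoundedBorel hK _) l]
  rw [hμ, hρ, ← hl]
  simp only [← Finset.sum_sub_distrib]
  refine (Finset.abs_sum_le_sum_abs _ _).trans (Finset.sum_le_sum fun i _ => ?_)
  refine (Finset.abs_sum_le_sum_abs _ _).trans (Finset.sum_le_sum fun k _ => ?_)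
  rcases (A i ∩ B k).eq_empty_or_nonempty with hempty | hne
  · simp [hempty, (μ i).empty', (ρ k).empty']
  · exact h i k hne

end IsBorelPartition

namespace IsTaggedPartition

variable {a b δ : ℝ} {n : ℕ} {t τ : ℕ → ℝ}

theorem isBorelPartition (h : IsTaggedPartition a b δ n t τ) :
    IsBorelPartition (Ioc a b) (fun i : Fin n => Ioc (t i) (t (i + 1))) := by
  have hmono : Monotone fun i => t (min i n) := by
    refine monotone_nat_of_le_succ fun i => ?_
    rcases lt_or_ge i n with hi | hi
    · rw [min_eq_left hi.le, min_eq_left (Nat.succ_le_of_lt hi)]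
      exact (h.lt i hi).le
    · rw [min_eq_right hi, min_eq_right (hi.trans (Nat.le_succ i))]
  have hmin (i : Fin n) : Ioc (t i) (t (i + 1)) = Ioc (t (min i n)) (t (min (i + 1) n)) := by
    rw [min_eq_left i.2.le, min_eq_left (Nat.succ_le_of_lt i.2)]
  refine ⟨fun _ => measurableSet_Ioc, fun i k hik => ?_, ?_⟩
  · simp only [Function.onFun]
    rw [hmin, hmin]
    exact hmono.pairwise_disjoint_on_Ioc_succ (fun hv => hik (Fin.ext hv))
  · have hU := hmono.biUnion_Ico_Ioc_map_succ 0 n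
    simp only [min_self, zero_le, min_eq_left, h.left, h.right] at hU
    ext s
    simp only [hmin, ← hU, mem_iUnion, mem_Ico, zero_le, true_and, Fin.exists_iff,
      Order.succ_eq_add_one]

theorem mono {δ' : ℝ} (h : IsTaggedPartition a b δ n t τ) (hδ : δ ≤ δ') :
    IsTaggedPartition a b δ' n t τ :=
  ⟨h.left, h.right, h.lt, h.tag, fun i hi => (h.mesh i hi).trans_le hδ⟩

theorem add_right (h : IsTaggedPartition a b δ n t τ) (c : ℝ) :
    IsTaggedPartition (a + c) (b + c) δ n (fun i => t i + c) fun i => τ i + c where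
  left := by rw [h.left]
  right := by rw [h.right]
  lt i hi := add_lt_add_left (h.lt i hi) c
  tag i hi := ⟨add_le_add_left (h.tag i hi).1 c, add_le_add_left (h.tag i hi).2 c⟩
  mesh i hi := by simpa only [add_sub_add_right_eq_sub] using h.mesh i hi

theorem tag_mem_Icc (h : IsTaggedPartition a b δ n t τ) {i : ℕ} (hi : i < n) : τ i ∈ Icc a b := by
  have hs := h.isBorelPartition.subset ⟨i, hi⟩
  rw [Ioc_subset_Ioc_iff (h.lt i hi)] at hs
  exact ⟨hs.2.trans (h.tag i hi).1, (h.tag i hi).2.trans hs.1⟩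

theorem abs_tag_sub_lt (h : IsTaggedPartition a b δ n t τ) {i : ℕ} (hi : i < n) {s : ℝ}
    (hs : s ∈ Ioc (t i) (t (i + 1))) : |τ i - s| < δ :=
  (Real.dist_le_of_mem_Icc (h.tag i hi) (Ioc_subset_Icc_self hs)).trans_lt (h.mesh i hi)

end IsTaggedPartition

theorem exists_isTaggedPartition {a b δ : ℝ} (hab : a < b) (hδ : 0 < δ) :
    ∃ n t τ, IsTaggedPartition a b δ n t τ := by
  obtain ⟨n, hn⟩ := exists_nat_gt ((b - a) / δ)
  have hn0 : (0 : ℝ) < n := (div_pos (sub_pos.2 hab) hδ).trans hn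
  set h := (b - a) / n with hh
  have hpos : 0 < h := div_pos (sub_pos.2 hab) hn0
  have hlt : h < δ := by
    rw [hh, div_lt_iff₀ hn0]
    rwa [div_lt_iff₀ hδ, mul_comm] at hn
  have hn' : (n : ℝ) * h = b - a := mul_div_cancel₀ _ hn0.ne'
  refine ⟨n, fun i => a + i * h, fun i => a + i * h, by simp, by simp [hn'],
    fun i _ => ?_, fun i _ => ⟨le_rfl, ?_⟩, fun i _ => ?_⟩ <;> push_cast <;> linarith

section RiemannSum

open Filter Topology

/-- The filter of tagged partitions `(n, t, τ)` of `[a, b]` as the mesh tends to `0`. -/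
def taggedPartitions (a b : ℝ) : Filter (ℕ × (ℕ → ℝ) × (ℕ → ℝ)) :=
  ⨅ (δ : ℝ) (_ : 0 < δ), 𝓟 {P | IsTaggedPartition a b δ P.1 P.2.1 P.2.2}

theorem hasBasis_taggedPartitions (a b : ℝ) : (taggedPartitions a b).HasBasis (0 < ·)
    fun δ => {P | IsTaggedPartition a b δ P.1 P.2.1 P.2.2} :=
  hasBasis_biInf_principal' (fun δ hδ δ' hδ' => ⟨min δ δ', lt_min hδ hδ',
    fun _ hP => hP.mono (min_le_left _ _), fun _ hP => hP.mono (min_le_right _ _)⟩) ⟨1, one_pos⟩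

theorem neBot_taggedPartitions {a b : ℝ} (hab : a < b) : (taggedPartitions a b).NeBot :=
  (hasBasis_taggedPartitions a b).neBot_iff.2 fun hδ =>
    let ⟨n, t, τ, hP⟩ := exists_isTaggedPartition hab hδ
    ⟨(n, t, τ), hP⟩

variable {N : ℕ} {ω : ℕ+ → ℝ≥0 → ℝ≥0} {a b : ℝ}

/-- The Riemann sum of `ν` along `y` over the tagged partition `P = (n, t, τ)`. -/
def riemannSum (ν : ParamBMeasure N ω) (y : ℝ → EuclideanSpace ℝ (Fin N))
    (P : ℕ × (ℕ → ℝ) × (ℕ → ℝ)) : ℝ :=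
  ∑ i ∈ Finset.range P.1, ν.1 (y (P.2.2 i)) (Icc (P.2.1 i) (P.2.1 (i + 1)))

theorem riemannSum_eq (ν : ParamBMeasure N ω) (y : ℝ → EuclideanSpace ℝ (Fin N)) {δ : ℝ}
    {P : ℕ × (ℕ → ℝ) × (ℕ → ℝ)} (hP : IsTaggedPartition a b δ P.1 P.2.1 P.2.2) :
    riemannSum ν y P = ∑ i : Fin P.1, ν.1 (y (P.2.2 i)) (Ioc (P.2.1 i) (P.2.1 (i + 1))) := by
  rw [riemannSum, Finset.sum_range]
  exact Finset.sum_congr rfl fun i _ => (ν.1 _).apply_Icc (hP.lt i i.2).le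

theorem hasParamIntegral_iff_tendsto {ν : ParamBMeasure N ω} {y : ℝ → EuclideanSpace ℝ (Fin N)}
    {L : ℝ} :
    HasParamIntegral ν a b y L ↔ Tendsto (riemannSum ν y) (taggedPartitions a b) (𝓝 L) := by
  simp only [(hasBasis_taggedPartitions a b).tendsto_iff Metric.nhds_basis_ball, Prod.forall,
    Metric.mem_ball, dist_comm _ L, Real.dist_eq]
  rfl

end RiemannSum

/-! ### The integral along a curve -/

section Integral

open MeasureTheory Filter Topology

variable {N : ℕ} {ω : ℕ+ → ℝ≥0 → ℝ≥0} {a b : ℝ} {y z : ℝ → EuclideanSpace ℝ (Fin N)} {j : ℕ+}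
  {l : Measure ℝ} {ν : ParamBMeasure N ω}

theorem IsLBound.abs_sub_le {ρ : EuclideanSpace ℝ (Fin N) → BMeasure} (hl : IsLBound ω ρ j l)
    {A : Set ℝ} (hA : IsBoundedBorel A) {x x' : EuclideanSpace ℝ (Fin N)} (hx : ‖x‖ ≤ (j : ℝ))
    (hx' : ‖x'‖ ≤ (j : ℝ)) : |ρ x A - ρ x' A| ≤ l.real A * ω j (nndist x x') := by
  have := hl.1.1
  have hle := ((ρ x - ρ x').ofReal_abs_le_totalVar hA.1).trans (hl.2 A hA x x' hx hx')
  have hne : l A * (ω j (nndist x x') : ℝ≥0∞) ≠ ⊤ :=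
    ENNReal.mul_ne_top hA.2.measure_lt_top.ne ENNReal.coe_ne_top
  simpa only [BMeasure.sub_apply, measureReal_def, ENNReal.toReal_mul, ENNReal.coe_toReal,
    nndist_eq_nnnorm] using
    (ENNReal.ofReal_le_iff_le_toReal hne).1 hle

theorem IsLBound.abs_sum_sub_sum_le (hω : IsModuliFamily ω)
    {ρ : EuclideanSpace ℝ (Fin N) → BMeasure} (hl : IsLBound ω ρ j l)
    {ι κ : Type*} [Fintype ι] [Fintype κ] {K : Set ℝ} (hK : IsBoundedBorel K)
    {A : ι → Set ℝ} {B : κ → Set ℝ} (hA : IsBorelPartition K A) (hB : IsBorelPartition K B)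
    {x : ι → EuclideanSpace ℝ (Fin N)} {x' : κ → EuclideanSpace ℝ (Fin N)}
    (hx : ∀ i, ‖x i‖ ≤ (j : ℝ)) (hx' : ∀ k, ‖x' k‖ ≤ (j : ℝ)) {η : ℝ≥0}
    (h : ∀ i k, ∀ s ∈ A i, s ∈ B k → nndist (x i) (x' k) ≤ η) :
    |∑ i, ρ (x i) (A i) - ∑ k, ρ (x' k) (B k)| ≤ l.real K * ω j η := by
  have := hl.1.1
  refine hA.abs_sum_sub_sum_le hB hK _ _ l _ fun i k ⟨s, hsA, hsB⟩ => ?_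
  refine (hl.abs_sub_le (hK.subset ((hA.measurableSet i).inter (hB.measurableSet k))
    (inter_subset_left.trans (hA.subset i))) (hx i) (hx' k)).trans ?_
  exact mul_le_mul_of_nonneg_left (NNReal.coe_le_coe.2 (hω.monotone j (h i k s hsA hsB)))
    measureReal_nonneg

theorem IsModuliFamily.tendsto_mul_add (hω : IsModuliFamily ω) (j : ℕ+) (C : ℝ) (η : ℝ≥0) :
    Tendsto (fun r : ℝ≥0 => C * (ω j (η + r) : ℝ)) (𝓝[>] 0) (𝓝 (C * ω j η)) := by
  have hc : Continuous fun r : ℝ≥0 => C * (ω j (η + r) : ℝ) :=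
    continuous_const.mul (NNReal.continuous_coe.comp
      ((hω.continuous j).comp (continuous_const.add continuous_id)))
  simpa only [add_zero] using (hc.tendsto 0).mono_left nhdsWithin_le_nhds

theorem eventually_taggedPartitions_nndist_le (hy : ContinuousOn y (Icc a b)) {η : ℝ≥0}
    (hη : 0 < η) : ∀ᶠ P in taggedPartitions a b, ∀ i < P.1,
      ∀ s ∈ Ioc (P.2.1 i) (P.2.1 (i + 1)), nndist (y (P.2.2 i)) (y s) ≤ η := by
  obtain ⟨δ, hδ, h⟩ := Metric.uniformContinuousOn_iff_le.1
    (isCompact_Icc.uniformContinuousOn_of_continuous hy) η hη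
  refine (hasBasis_taggedPartitions a b).mem_of_mem hδ |> Filter.mem_of_superset <|
    fun P hP i hi s hs => ?_
  have hsI : s ∈ Icc a b := Ioc_subset_Icc_self (hP.isBorelPartition.subset ⟨i, hi⟩ hs)
  simpa only [dist_nndist, NNReal.coe_le_coe] using
    h _ (hP.tag_mem_Icc hi) s hsI (by simpa only [Real.dist_eq] using (hP.abs_tag_sub_lt hi hs).le)

theorem eventually_taggedPartitions_isTaggedPartition (a b : ℝ) :
    ∀ᶠ P in taggedPartitions a b, IsTaggedPartition a b 1 P.1 P.2.1 P.2.2 :=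
  (hasBasis_taggedPartitions a b).mem_of_mem one_pos

theorem exists_hasParamIntegral (hω : IsModuliFamily ω) (ν : ParamBMeasure N ω) (hab : a < b)
    (hy : ContinuousOn y (Icc a b)) (hyj : ∀ s ∈ Icc a b, ‖y s‖ ≤ (j : ℝ)) :
    ∃ L, HasParamIntegral ν a b y L := by
  obtain ⟨-, l, hl⟩ := ν.2 j
  simp only [hasParamIntegral_iff_tendsto]
  have := neBot_taggedPartitions hab
  refine cauchy_map_iff_exists_tendsto.1 (Metric.cauchy_iff.2 ⟨inferInstance, fun ε hε => ?_⟩)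
  have hsmall : Tendsto (fun r : ℝ≥0 => l.real (Ioc a b) * (ω j (0 + r) : ℝ)) (𝓝[>] 0) (𝓝 0) := by
    simpa only [hω.zero, NNReal.coe_zero, mul_zero] using
      hω.tendsto_mul_add j (l.real (Ioc a b)) 0
  obtain ⟨η, hηε, hη⟩ := ((hsmall.eventually_lt_const hε).and self_mem_nhdsWithin).exists
  have hη : 0 < η := hη
  refine ⟨_, image_mem_map ((eventually_taggedPartitions_nndist_le hy (half_pos hη)).and
    (eventually_taggedPartitions_isTaggedPartition a b)), ?_⟩
  rintro _ ⟨P, ⟨hPy, hP⟩, rfl⟩ _ ⟨Q, ⟨hQy, hQ⟩, rfl⟩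
  rw [Real.dist_eq, riemannSum_eq ν y hP, riemannSum_eq ν y hQ]
  refine (hl.abs_sum_sub_sum_le hω (isBoundedBorel_Ioc a b) hP.isBorelPartition
    hQ.isBorelPartition (fun i => hyj _ (hP.tag_mem_Icc i.2))
    (fun k => hyj _ (hQ.tag_mem_Icc k.2)) fun i k s hsP hsQ => ?_).trans_lt hηε
  rw [zero_add, ← add_halves η]
  refine (nndist_triangle _ (y s) _).trans
    (add_le_add (hPy i i.2 s hsP) ?_)
  rw [nndist_comm]
  exact hQy k k.2 s hsQ

theorem HasParamIntegral.paramIntegral_eq (hab : a < b) {L : ℝ} (h : HasParamIntegral ν a b y L) :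
    paramIntegral ν a b y = L := by
  have hex : ∃ L, HasParamIntegral ν a b y L := ⟨L, h⟩
  have := neBot_taggedPartitions hab
  rw [paramIntegral, dif_pos hex]
  exact tendsto_nhds_unique (hasParamIntegral_iff_tendsto.1 hex.choose_spec)
    (hasParamIntegral_iff_tendsto.1 h)

theorem hasParamIntegral_paramIntegral (hω : IsModuliFamily ω) (ν : ParamBMeasure N ω)
    (hab : a < b) (hy : ContinuousOn y (Icc a b)) (hyj : ∀ s ∈ Icc a b, ‖y s‖ ≤ (j : ℝ)) :
    HasParamIntegral ν a b y (paramIntegral ν a b y) := by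
  obtain ⟨L, hL⟩ := exists_hasParamIntegral hω ν hab hy hyj
  rwa [hL.paramIntegral_eq hab]

theorem tendsto_riemannSum (hω : IsModuliFamily ω) (ν : ParamBMeasure N ω)
    (hab : a < b) (hy : ContinuousOn y (Icc a b)) (hyj : ∀ s ∈ Icc a b, ‖y s‖ ≤ (j : ℝ)) :
    Tendsto (riemannSum ν y) (taggedPartitions a b) (𝓝 (paramIntegral ν a b y)) :=
  hasParamIntegral_iff_tendsto.1 (hasParamIntegral_paramIntegral hω ν hab hy hyj)

theorem paramIntegral_add (hω : IsModuliFamily ω) (ν ν' : ParamBMeasure N ω) (hab : a < b)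
    (hy : ContinuousOn y (Icc a b)) (hyj : ∀ s ∈ Icc a b, ‖y s‖ ≤ (j : ℝ)) :
    paramIntegral (ν + ν') a b y = paramIntegral ν a b y + paramIntegral ν' a b y := by
  refine HasParamIntegral.paramIntegral_eq hab (hasParamIntegral_iff_tendsto.2 ?_)
  refine ((tendsto_riemannSum hω ν hab hy hyj).add
    (tendsto_riemannSum hω ν' hab hy hyj)).congr fun P => ?_
  exact Finset.sum_add_distrib.symm

theorem paramIntegral_sub (hω : IsModuliFamily ω) (ν ν' : ParamBMeasure N ω) (hab : a < b)
    (hy : ContinuousOn y (Icc a b)) (hyj : ∀ s ∈ Icc a b, ‖y s‖ ≤ (j : ℝ)) :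
    paramIntegral (ν - ν') a b y = paramIntegral ν a b y - paramIntegral ν' a b y := by
  rw [eq_sub_iff_add_eq, ← paramIntegral_add hω _ _ hab hy hyj, sub_add_cancel]

theorem paramIntegral_smul (hω : IsModuliFamily ω) (c : ℝ) (ν : ParamBMeasure N ω) (hab : a < b)
    (hy : ContinuousOn y (Icc a b)) (hyj : ∀ s ∈ Icc a b, ‖y s‖ ≤ (j : ℝ)) :
    paramIntegral (c • ν) a b y = c * paramIntegral ν a b y := by
  refine HasParamIntegral.paramIntegral_eq hab (hasParamIntegral_iff_tendsto.2 ?_)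
  refine ((tendsto_riemannSum hω ν hab hy hyj).const_mul c).congr fun P => ?_
  exact Finset.mul_sum ..

theorem paramIntegral_congr (h : EqOn y z (Icc a b)) :
    paramIntegral ν a b y = paramIntegral ν a b z := by
  have hiff (L : ℝ) : HasParamIntegral ν a b y L ↔ HasParamIntegral ν a b z L := by
    simp only [hasParamIntegral_iff_tendsto]
    refine tendsto_congr' ?_
    filter_upwards [eventually_taggedPartitions_isTaggedPartition a b] with P hP
    exact Finset.sum_congr rfl fun i hi => by rw [h (hP.tag_mem_Icc (Finset.mem_range.1 hi))]
  unfold paramIntegral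
  rw [show HasParamIntegral ν a b y = HasParamIntegral ν a b z from
    funext fun L => propext (hiff L)]

theorem paramIntegral_const (ν : ParamBMeasure N ω) (hab : a < b)
    (x : EuclideanSpace ℝ (Fin N)) : paramIntegral ν a b (fun _ => x) = ν.1 x (Ioc a b) := by
  refine HasParamIntegral.paramIntegral_eq hab (hasParamIntegral_iff_tendsto.2 ?_)
  refine tendsto_const_nhds.congr' ?_
  filter_upwards [eventually_taggedPartitions_isTaggedPartition a b] with P hP
  rw [riemannSum_eq ν _ hP, hP.isBorelPartition.sum_apply (isBoundedBorel_Ioc a b)]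

theorem abs_paramIntegral_sub_sum_le (hω : IsModuliFamily ω) (hab : a < b)
    (hl : IsLBound ω ν.1 j l) (hy : ContinuousOn y (Icc a b))
    (hyj : ∀ s ∈ Icc a b, ‖y s‖ ≤ (j : ℝ)) {ι : Type*} [Fintype ι] {A : ι → Set ℝ}
    (hA : IsBorelPartition (Ioc a b) A) {x : ι → EuclideanSpace ℝ (Fin N)}
    (hx : ∀ i, ‖x i‖ ≤ (j : ℝ)) {η : ℝ≥0} (h : ∀ i, ∀ s ∈ A i, nndist (y s) (x i) ≤ η) :
    |paramIntegral ν a b y - ∑ i, ν.1 (x i) (A i)| ≤ l.real (Ioc a b) * ω j η := by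
  have := neBot_taggedPartitions hab
  refine ge_of_tendsto (hω.tendsto_mul_add j _ η) (eventually_mem_nhdsWithin.mono fun r hr => ?_)
  refine le_of_tendsto ((tendsto_riemannSum hω ν hab hy hyj).sub_const _).abs ?_
  filter_upwards [eventually_taggedPartitions_nndist_le hy hr,
    eventually_taggedPartitions_isTaggedPartition a b] with P hPy hP
  rw [riemannSum_eq ν y hP]
  refine hl.abs_sum_sub_sum_le hω (isBoundedBorel_Ioc a b) hP.isBorelPartition hA
    (fun i => hyj _ (hP.tag_mem_Icc i.2)) hx fun i k s hsP hsA => ?_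
  rw [add_comm]
  exact (nndist_triangle _ (y s) _).trans
    (add_le_add (hPy i i.2 s hsP) (h k s hsA))

theorem abs_paramIntegral_sub_le (hω : IsModuliFamily ω) (hab : a < b) (hl : IsLBound ω ν.1 j l)
    (hy : ContinuousOn y (Icc a b)) (hyj : ∀ s ∈ Icc a b, ‖y s‖ ≤ (j : ℝ))
    (hz : ContinuousOn z (Icc a b)) (hzj : ∀ s ∈ Icc a b, ‖z s‖ ≤ (j : ℝ)) {η : ℝ≥0}
    (h : ∀ s ∈ Icc a b, nndist (y s) (z s) ≤ η) :
    |paramIntegral ν a b y - paramIntegral ν a b z| ≤ l.real (Ioc a b) * ω j η := by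
  have := neBot_taggedPartitions hab
  refine ge_of_tendsto (hω.tendsto_mul_add j _ η) (eventually_mem_nhdsWithin.mono fun r hr => ?_)
  refine le_of_tendsto ((tendsto_riemannSum hω ν hab hz hzj).const_sub _).abs ?_
  filter_upwards [eventually_taggedPartitions_nndist_le hz hr,
    eventually_taggedPartitions_isTaggedPartition a b] with P hPz hP
  rw [riemannSum_eq ν z hP]
  refine abs_paramIntegral_sub_sum_le hω hab hl hy hyj hP.isBorelPartition
    (fun i => hzj _ (hP.tag_mem_Icc i.2)) fun i s hs => ?_
  have hsI : s ∈ Icc a b := Ioc_subset_Icc_self (hP.isBorelPartition.subset i hs)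
  refine (nndist_triangle _ (z s) _).trans (add_le_add (h s hsI) ?_)
  rw [nndist_comm]
  exact hPz i i.2 s hs

theorem paramIntegral_add_adjacent (hω : IsModuliFamily ω) (ν : ParamBMeasure N ω) {c : ℝ}
    (hab : a < b) (hbc : b < c) (hy : ContinuousOn y (Icc a c))
    (hyj : ∀ s ∈ Icc a c, ‖y s‖ ≤ (j : ℝ)) :
    paramIntegral ν a b y + paramIntegral ν b c y = paramIntegral ν a c y := by
  obtain ⟨-, l, hl⟩ := ν.2 j
  have := neBot_taggedPartitions hab
  have := neBot_taggedPartitions hbc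
  have hab' : Icc a b ⊆ Icc a c := Icc_subset_Icc_right hbc.le
  have hbc' : Icc b c ⊆ Icc a c := Icc_subset_Icc_left hab.le
  have hlim := (tendsto_riemannSum hω ν hab (hy.mono hab') fun s hs => hyj s (hab' hs)).comp
    (tendsto_fst (g := taggedPartitions b c)) |>.add <|
    (tendsto_riemannSum hω ν hbc (hy.mono hbc') fun s hs => hyj s (hbc' hs)).comp
    (tendsto_snd (f := taggedPartitions a b))
  suffices |paramIntegral ν a c y - (paramIntegral ν a b y + paramIntegral ν b c y)| ≤ 0 from
    (sub_eq_zero.1 (abs_nonpos_iff.1 this)).symm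
  have h0 : l.real (Ioc a c) * (ω j 0 : ℝ) = 0 := by rw [hω.zero, NNReal.coe_zero, mul_zero]
  refine (ge_of_tendsto (hω.tendsto_mul_add j (l.real (Ioc a c)) 0)
    (eventually_mem_nhdsWithin.mono fun r hr => ?_)).trans_eq h0
  refine le_of_tendsto (hlim.const_sub _).abs ?_
  filter_upwards [((eventually_taggedPartitions_nndist_le (hy.mono hab') hr).and
    (eventually_taggedPartitions_isTaggedPartition a b)).prod_mk
    ((eventually_taggedPartitions_nndist_le (hy.mono hbc') hr).and
    (eventually_taggedPartitions_isTaggedPartition b c))] with ⟨P, Q⟩ ⟨⟨hPy, hP⟩, hQy, hQ⟩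
  have hPQ := hP.isBorelPartition.sumElim hQ.isBorelPartition (Ioc_disjoint_Ioc_of_le le_rfl)
  rw [Ioc_union_Ioc_eq_Ioc hab.le hbc.le] at hPQ
  simp only [Function.comp_apply]
  rw [riemannSum_eq ν y hP, riemannSum_eq ν y hQ, zero_add]
  have := abs_paramIntegral_sub_sum_le hω (hab.trans hbc) hl hy hyj hPQ
    (x := Sum.elim (fun i => y (P.2.2 i)) fun i => y (Q.2.2 i)) (η := r)
    (Sum.rec (fun i => hyj _ (hab' (hP.tag_mem_Icc i.2)))
      fun i => hyj _ (hbc' (hQ.tag_mem_Icc i.2)))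
    (Sum.rec (fun i s hs => by rw [nndist_comm]; exact hPy i i.2 s hs)
      fun i s hs => by rw [nndist_comm]; exact hQy i i.2 s hs)
  simpa only [Fintype.sum_sum_type, Sum.elim_inl, Sum.elim_inr] using this

theorem paramIntegral_translate (hω : IsModuliFamily ω) (ν : ParamBMeasure N ω) (hab : a < b)
    {t : ℝ} (hy : ContinuousOn y (Icc (a + t) (b + t)))
    (hyj : ∀ s ∈ Icc (a + t) (b + t), ‖y s‖ ≤ (j : ℝ)) :
    paramIntegral (ParamBMeasure.translate ν t) a b (fun s => y (s + t)) =
      paramIntegral ν (a + t) (b + t) y := by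
  refine HasParamIntegral.paramIntegral_eq hab fun ε hε => ?_
  obtain ⟨δ, hδ, h⟩ := hasParamIntegral_paramIntegral hω ν (by linarith) hy hyj ε hε
  refine ⟨δ, hδ, fun n u τ hP => ?_⟩
  have himage (x : EuclideanSpace ℝ (Fin N)) (c d : ℝ) :
      (ParamBMeasure.translate ν t).1 x (Icc c d) = ν.1 x (Icc (c + t) (d + t)) :=
    congrArg (ν.1 x).toFun (image_add_const_Icc t c d)
  simpa only [himage] using h n _ _ (hP.add_right t)

end Integral

/-! ### The seminorm topologies -/

section SeminormTopology

open Filter Topology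

variable {𝕜 E : Type*} [NormedField 𝕜] [AddCommGroup E] [Module 𝕜 E]

theorem generateFrom_ball_eq (p : Seminorm 𝕜 E) :
    TopologicalSpace.generateFrom {U | ∃ x r, 0 < r ∧ U = p.ball x r} =
      p.toSeminormedAddCommGroup.toUniformSpace.toTopologicalSpace := by
  let := p.toSeminormedAddCommGroup
  simp only [Seminorm.ball_eq_metric]
  refine (TopologicalSpace.IsTopologicalBasis.eq_generateFrom
    (TopologicalSpace.isTopologicalBasis_of_isOpen_of_nhds ?_ fun x U hx hU => ?_)).symm
  · rintro _ ⟨x, r, -, rfl⟩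
    exact Metric.isOpen_ball
  · obtain ⟨r, hr, hball⟩ := Metric.isOpen_iff.1 hU x hx
    exact ⟨_, ⟨x, r, hr, rfl⟩, Metric.mem_ball_self hr, hball⟩

theorem withSeminorms_of_eq_generateFrom_ball {ι : Type*} [t : TopologicalSpace E]
    (p : SeminormFamily 𝕜 E ι)
    (h : t = TopologicalSpace.generateFrom {U | ∃ i x r, 0 < r ∧ U = (p i).ball x r}) :
    WithSeminorms p := by
  have hunion : {U | ∃ i x r, 0 < r ∧ U = (p i).ball x r} =
      ⋃ i, {U | ∃ x r, 0 < r ∧ U = (p i).ball x r} := ext fun U => by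
    simp only [mem_ofPred_eq, mem_iUnion]
  rw [hunion, generateFrom_iUnion, iInf_congr fun i => generateFrom_ball_eq (p i)] at h
  have : IsTopologicalAddGroup E := h ▸ topologicalAddGroup_iInf fun i => by
    let := (p i).toSeminormedAddCommGroup
    infer_instance
  exact p.withSeminorms_iff_topologicalSpace_eq_iInf.2 h

theorem isCompact_closure_of_ultrafilter_le_nhds {Y : Type*} [TopologicalSpace Y] [RegularSpace Y]
    {S : Set Y} (h : ∀ F : Ultrafilter Y, S ∈ F → ∃ x, (F : Filter Y) ≤ 𝓝 x) :
    IsCompact (closure S) := by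
  rw [isCompact_iff_ultrafilter_le_nhds']
  intro G hG
  have hne : ((G : Filter Y).bind 𝓝 ⊓ 𝓟 S).NeBot := inf_principal_neBot_iff.2 fun U hU => by
    obtain ⟨x, hxU, hxS⟩ := G.nonempty_of_mem (inter_mem (mem_bind'.1 hU) hG)
    exact mem_closure_iff_nhds.1 hxS U hxU
  obtain ⟨hbind, hS⟩ := le_inf_iff.1 (Ultrafilter.of_le ((G : Filter Y).bind 𝓝 ⊓ 𝓟 S))
  obtain ⟨x, hx⟩ := h _ (le_principal_iff.1 hS)
  have hGx : (G : Filter Y) ≤ 𝓝 x := fun V hV => by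
    obtain ⟨W, hW, hWc, hWV⟩ := exists_mem_nhds_isClosed_subset hV
    refine mem_of_superset (by_contra fun hWG => ?_) hWV
    have hcompl : Wᶜ ∈ (G : Filter Y).bind 𝓝 :=
      mem_bind'.2 (mem_of_superset (Ultrafilter.compl_mem_iff_notMem.2 hWG)
        fun z hz => hWc.isOpen_compl.mem_nhds hz)
    exact Ultrafilter.compl_mem_iff_notMem.1 (hbind hcompl) (hx hW)
  exact ⟨x, isClosed_closure.mem_of_frequently_of_tendsto (Eventually.frequently hG)
    (tendsto_id'.2 hGx), hGx⟩

end SeminormTopology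

section Seminorms

variable {N : ℕ} {ω : ℕ+ → ℝ≥0 → ℝ≥0} {θ : ℕ+ → ℚ → ℚ → ℝ≥0 → ℝ≥0} {j : ℕ+} {q₁ q₂ : ℚ}

theorem seminormTheta_ne_top (hω : IsModuliFamily ω) (hq : q₁ < q₂) (ν : ParamBMeasure N ω) :
    seminormTheta θ j q₁ q₂ ν ≠ ⊤ := by
  obtain ⟨-, l, hl⟩ := ν.2 j
  have hq' : (q₁ : ℝ) < q₂ := Rat.cast_lt.2 hq
  have hbound (y : ℝ → EuclideanSpace ℝ (Fin N)) (hy : y ∈ curveSet N θ j q₁ q₂) :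
      |paramIntegral ν q₁ q₂ y| ≤
        l.real (Ioc (q₁ : ℝ) q₂) * ω j (j : ℝ≥0) + |ν.1 0 (Ioc (q₁ : ℝ) q₂)| := by
    rw [← paramIntegral_const ν hq' 0, ← sub_le_iff_le_add]
    refine (abs_sub_abs_le_abs_sub _ _).trans <| abs_paramIntegral_sub_le hω hq' hl hy.1 hy.2.1
      continuousOn_const (fun _ _ => by simp) fun s hs => ?_
    rw [nndist_zero_right]
    exact_mod_cast hy.2.1 s hs
  exact ne_top_of_le_ne_top ENNReal.ofReal_ne_top
    (iSup₂_le fun y hy => ENNReal.ofReal_le_ofReal (hbound y hy))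

theorem abs_paramIntegral_le_toReal_seminormTheta (hω : IsModuliFamily ω) (hq : q₁ < q₂)
    (ν : ParamBMeasure N ω) {y : ℝ → EuclideanSpace ℝ (Fin N)} (hy : y ∈ curveSet N θ j q₁ q₂) :
    |paramIntegral ν q₁ q₂ y| ≤ (seminormTheta θ j q₁ q₂ ν).toReal := by
  rw [← ENNReal.ofReal_le_iff_le_toReal (seminormTheta_ne_top hω hq ν)]
  exact le_iSup₂ (f := fun y (_ : y ∈ curveSet N θ j q₁ q₂) =>
    ENNReal.ofReal |paramIntegral ν q₁ q₂ y|) y hy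

theorem toReal_seminormTheta_le {ν : ParamBMeasure N ω} {C : ℝ} (hC : 0 ≤ C)
    (h : ∀ y ∈ curveSet N θ j q₁ q₂, |paramIntegral ν q₁ q₂ y| ≤ C) :
    (seminormTheta θ j q₁ q₂ ν).toReal ≤ C :=
  ENNReal.toReal_le_of_le_ofReal hC
    (iSup₂_le fun y hy => ENNReal.ofReal_le_ofReal (h y hy))

/-- The seminorms `p_{I,j}` that define `σ_Θ`, as a family of real-valued seminorms. -/
noncomputable def seminormFamilyTheta (N : ℕ) (hω : IsModuliFamily ω)
    (θ : ℕ+ → ℚ → ℚ → ℝ≥0 → ℝ≥0) :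
    SeminormFamily ℝ (ParamBMeasure N ω) (ℕ+ × {q : ℚ × ℚ // q.1 < q.2}) := fun i =>
  Seminorm.ofSMulLE (fun ν => (seminormTheta θ i.1 i.2.1.1 i.2.1.2 ν).toReal)
    (le_antisymm (toReal_seminormTheta_le le_rfl fun y hy => by
      have h := paramIntegral_smul hω 0 (0 : ParamBMeasure N ω) (Rat.cast_lt.2 i.2.2) hy.1 hy.2.1
      rw [zero_smul, zero_mul] at h
      rw [h, abs_zero]) ENNReal.toReal_nonneg)
    (fun ν ν' => toReal_seminormTheta_le (by positivity) fun y hy => by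
      rw [paramIntegral_add hω ν ν' (Rat.cast_lt.2 i.2.2) hy.1 hy.2.1]
      exact (abs_add_le _ _).trans (add_le_add
        (abs_paramIntegral_le_toReal_seminormTheta hω i.2.2 ν hy)
        (abs_paramIntegral_le_toReal_seminormTheta hω i.2.2 ν' hy)))
    (fun c ν => toReal_seminormTheta_le (by positivity) fun y hy => by
      rw [paramIntegral_smul hω c ν (Rat.cast_lt.2 i.2.2) hy.1 hy.2.1, abs_mul, Real.norm_eq_abs]
      gcongr
      exact abs_paramIntegral_le_toReal_seminormTheta hω i.2.2 ν hy)

theorem withSeminorms_sigmaTheta (hω : IsModuliFamily ω) (θ : ℕ+ → ℚ → ℚ → ℝ≥0 → ℝ≥0) :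
    WithSeminorms (topology := sigmaTheta N ω θ) (seminormFamilyTheta N hω θ) := by
  have hball {j : ℕ+} {q₁ q₂ : ℚ} (hq : q₁ < q₂) (ν : ParamBMeasure N ω) (r : ℝ) :
      {μ | seminormTheta θ j q₁ q₂ (μ - ν) < ENNReal.ofReal r} =
        (seminormFamilyTheta N hω θ (j, ⟨(q₁, q₂), hq⟩)).ball ν r :=
    ext fun μ => ENNReal.lt_ofReal_iff_toReal_lt (seminormTheta_ne_top hω hq _)
  refine withSeminorms_of_eq_generateFrom_ball (t := sigmaTheta N ω θ) _
    (congrArg TopologicalSpace.generateFrom (ext fun U => ⟨?_, ?_⟩))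
  · rintro ⟨j, q₁, q₂, ν, r, hq, hr, rfl⟩
    exact ⟨(j, ⟨(q₁, q₂), hq⟩), ν, r, hr, hball hq ν r⟩
  · rintro ⟨⟨j, ⟨q₁, q₂⟩, hq⟩, ν, r, hr, rfl⟩
    exact ⟨j, q₁, q₂, ν, r, hq, hr, (hball hq ν r).symm⟩

/-- The seminorms `p_{I,y}`, `y ∈ D`, that define `σ_D`. -/
def seminormFamilyD (ω : ℕ+ → ℝ≥0 → ℝ≥0) (D : Set (EuclideanSpace ℝ (Fin N))) :
    SeminormFamily ℝ (ParamBMeasure N ω) (D × {q : ℚ × ℚ // q.1 < q.2}) := fun i =>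
  Seminorm.of (seminormD i.1.1 i.2.1.1 i.2.1.2) (fun _ _ => abs_add_le _ _) fun _ _ => abs_mul _ _

theorem seminormFamilyD_apply (D : Set (EuclideanSpace ℝ (Fin N)))
    (i : D × {q : ℚ × ℚ // q.1 < q.2}) (ν : ParamBMeasure N ω) :
    seminormFamilyD ω D i ν = |ν.1 i.1 (Ioc (i.2.1.1 : ℝ) i.2.1.2)| :=
  congrArg abs ((ν.1 i.1).apply_Icc (Rat.cast_le.2 i.2.2.le))

theorem withSeminorms_sigmaD (ω : ℕ+ → ℝ≥0 → ℝ≥0) (D : Set (EuclideanSpace ℝ (Fin N))) :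
    WithSeminorms (topology := sigmaD N ω D) (seminormFamilyD ω D) := by
  refine withSeminorms_of_eq_generateFrom_ball (t := sigmaD N ω D) _
    (congrArg TopologicalSpace.generateFrom (ext fun U => ⟨?_, ?_⟩))
  · rintro ⟨y, hy, q₁, q₂, ν, r, hq, hr, rfl⟩
    exact ⟨(⟨y, hy⟩, ⟨(q₁, q₂), hq⟩), ν, r, hr, rfl⟩
  · rintro ⟨⟨⟨y, hy⟩, ⟨q₁, q₂⟩, hq⟩, ν, r, hr, rfl⟩
    exact ⟨y, hy, q₁, q₂, ν, r, hq, hr, rfl⟩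

end Seminorms

/-! ### Continuity of the translation -/

section MBounds

open MeasureTheory

variable {N : ℕ} {ρ : EuclideanSpace ℝ (Fin N) → BMeasure} {j : ℕ+} {m : Measure ℝ}
  {x : EuclideanSpace ℝ (Fin N)}

theorem IsMBound.abs_apply_le (hm : IsMBound ρ j m) {A : Set ℝ} (hA : IsBoundedBorel A)
    (hx : ‖x‖ ≤ (j : ℝ)) : |ρ x A| ≤ m.real A := by
  have := hm.1.1
  exact (ENNReal.ofReal_le_iff_le_toReal hA.2.measure_lt_top.ne).1
    (((ρ x).ofReal_abs_le_totalVar hA.1).trans (hm.2 A hA x hx))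

theorem IsMBound.abs_cdf_sub_le (hm : IsMBound ρ j m) (hx : ‖x‖ ≤ (j : ℝ)) (s t : ℝ) :
    |(ρ x).cdf t - (ρ x).cdf s| ≤
      |(BMeasure.ofMeasure m hm.1).cdf t - (BMeasure.ofMeasure m hm.1).cdf s| := by
  have hA : IsBoundedBorel (uIoc s t) := isBoundedBorel_Ioc _ _
  rw [BMeasure.abs_cdf_sub, BMeasure.abs_cdf_sub, BMeasure.ofMeasure_apply hm.1 hA,
    abs_of_nonneg measureReal_nonneg]
  exact hm.abs_apply_le hA hx

theorem exists_norm_le_pnat {E : Type*} [Norm E] (x : E) : ∃ j : ℕ+, ‖x‖ ≤ (j : ℝ) := by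
  refine ⟨⌈‖x‖⌉₊.succPNat, (Nat.le_ceil ‖x‖).trans ?_⟩
  rw [Nat.succPNat_coe]
  exact_mod_cast Nat.le_succ _

end MBounds

namespace ParamBMeasure

variable {N : ℕ} {ω : ℕ+ → ℝ≥0 → ℝ≥0}

theorem translate_apply_Ioc (ν : ParamBMeasure N ω) (t : ℝ) (x : EuclideanSpace ℝ (Fin N))
    (a b : ℝ) : (translate ν t).1 x (Ioc a b) = ν.1 x (Ioc (a + t) (b + t)) :=
  (ν.1 x).translate_Ioc t a b

theorem translate_zero (ν : ParamBMeasure N ω) : translate ν 0 = ν :=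
  Subtype.ext (funext fun x => (ν.1 x).translate_zero)

theorem translate_translate (ν : ParamBMeasure N ω) (s t : ℝ) :
    translate (translate ν s) t = translate ν (s + t) :=
  Subtype.ext (funext fun x => (ν.1 x).translate_translate s t)

theorem translate_sub (ν ν' : ParamBMeasure N ω) (t : ℝ) :
    translate (ν - ν') t = translate ν t - translate ν' t := rfl

end ParamBMeasure

section EquiOsc

variable {N : ℕ} {ω : ℕ+ → ℝ≥0 → ℝ≥0}

/-- The distribution functions of `ν_x`, `ν ∈ S`, `x ∈ P ∩ B_j`, are uniformly equicontinuous for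
every `j`.  In contrast to the existence of equicontinuous `m`-bounds this passes to closures. -/
def EquiOscOn (P : Set (EuclideanSpace ℝ (Fin N))) (S : Set (ParamBMeasure N ω)) : Prop :=
  ∀ (j : ℕ+) (ε : ℝ), 0 < ε → ∃ δ > 0, ∀ ν ∈ S, ∀ x ∈ P, ‖x‖ ≤ (j : ℝ) → (ν.1 x).OscLE δ ε

open scoped Pointwise in
theorem EquiOscOn.sub {P : Set (EuclideanSpace ℝ (Fin N))} {S : Set (ParamBMeasure N ω)}
    (hS : EquiOscOn P S) : EquiOscOn P (S - S) := fun j ε hε => by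
  obtain ⟨δ, hδ, h⟩ := hS j (ε / 2) (half_pos hε)
  refine ⟨δ, hδ, ?_⟩
  rintro _ ⟨ν, hν, ν', hν', rfl⟩ x hxP hx
  rw [← add_halves ε]
  exact (h ν hν x hxP hx).sub (h ν' hν' x hxP hx)

end EquiOsc

section ShiftExtend

variable {N : ℕ} {ω : ℕ+ → ℝ≥0 → ℝ≥0} {θ : ℕ+ → ℚ → ℚ → ℝ≥0 → ℝ≥0} {j : ℕ+} {a b : ℝ}
  {y : ℝ → EuclideanSpace ℝ (Fin N)}

/-- The curve `y` on `[a, b]`, shifted to `[a + τ, b + τ]` and extended from there to `ℝ` by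
constants.  In this way the curves in `𝓚_j^I`, shifted by small amounts, become curves on one
common larger interval. -/
noncomputable def shiftExtend {E : Type*} (hab : a ≤ b) (τ : ℝ) (y : ℝ → E) (s : ℝ) : E :=
  y (projIcc a b hab (s - τ))

theorem continuous_shiftExtend (hab : a ≤ b) (τ : ℝ) (hy : ContinuousOn y (Icc a b)) :
    Continuous (shiftExtend hab τ y) :=
  (continuousOn_iff_continuous_domRestrict.1 hy).comp
    (continuous_projIcc.comp (continuous_id.sub continuous_const))

theorem norm_shiftExtend_le (hab : a ≤ b) (τ : ℝ) (hyj : ∀ s ∈ Icc a b, ‖y s‖ ≤ (j : ℝ)) (s : ℝ) :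
    ‖shiftExtend hab τ y s‖ ≤ (j : ℝ) :=
  hyj _ (Subtype.coe_prop _)

theorem paramIntegral_shiftExtend (hω : IsModuliFamily ω) (ν : ParamBMeasure N ω) (hab : a < b)
    (hy : ContinuousOn y (Icc a b)) (hyj : ∀ s ∈ Icc a b, ‖y s‖ ≤ (j : ℝ)) {p q τ : ℝ}
    (hp : p < a + τ) (hq : b + τ < q) :
    paramIntegral ν p q (shiftExtend hab.le τ y) = ν.1 (y a) (Ioc p (a + τ)) +
      paramIntegral (ParamBMeasure.translate ν τ) a b y + ν.1 (y b) (Ioc (b + τ) q) := by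
  have hz := continuous_shiftExtend hab.le τ hy
  have hzj := norm_shiftExtend_le hab.le τ hyj
  have hab' : a + τ < b + τ := by linarith
  have hleft : EqOn (shiftExtend hab.le τ y) (fun _ => y a) (Icc p (a + τ)) := fun s hs => by
    rw [shiftExtend, projIcc_of_le_left hab.le (by linarith [hs.2])]
  have hright : EqOn (shiftExtend hab.le τ y) (fun _ => y b) (Icc (b + τ) q) := fun s hs => by
    rw [shiftExtend, projIcc_of_right_le hab.le (by linarith [hs.1])]
  have hmiddle : EqOn (fun s => shiftExtend hab.le τ y (s + τ)) y (Icc a b) := fun s hs => by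
    simp only [shiftExtend, add_sub_cancel_right, projIcc_of_mem hab.le hs]
  rw [← paramIntegral_add_adjacent hω ν (hp.trans hab') hq hz.continuousOn fun s _ => hzj s,
    ← paramIntegral_add_adjacent hω ν hp hab' hz.continuousOn fun s _ => hzj s,
    ← paramIntegral_translate hω ν hab hz.continuousOn fun s _ => hzj s,
    paramIntegral_congr hleft, paramIntegral_congr hright, paramIntegral_congr hmiddle,
    paramIntegral_const ν hp, paramIntegral_const ν hq]

variable {q₁ q₂ p₁ p₂ : ℚ}

theorem nndist_shiftExtend_le (hθ : IsSuitable θ) (hq : q₁ < q₂) (hq' : (q₁ : ℝ) ≤ q₂)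
    (hy : y ∈ curveSet N θ j q₁ q₂) (τ τ' s s' : ℝ) :
    nndist (shiftExtend hq' τ y s) (shiftExtend hq' τ' y s') ≤
      θ j q₁ q₂ (nndist (s - τ) (s' - τ')) := by
  rw [nndist_eq_nnnorm, nndist_eq_nnnorm]
  exact (hy.2.2 _ (Subtype.coe_prop _) _ (Subtype.coe_prop _)).trans
    (hθ.monotone j q₁ q₂ hq (abs_projIcc_sub_projIcc hq'))

theorem shiftExtend_mem_curveSet (hθ : IsSuitable θ) (hq : q₁ < q₂) (hq' : (q₁ : ℝ) ≤ q₂)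
    (hp₁ : p₁ ≤ q₁) (hp₂ : q₂ ≤ p₂) (hy : y ∈ curveSet N θ j q₁ q₂) (τ : ℝ) :
    shiftExtend hq' τ y ∈ curveSet N θ j p₁ p₂ := by
  refine ⟨(continuous_shiftExtend hq' τ hy.1).continuousOn,
    fun s _ => norm_shiftExtend_le hq' τ hy.2.1 s, fun s _ s' _ => ?_⟩
  have h := nndist_shiftExtend_le hθ hq hq' hy τ τ s s'
  rw [nndist_sub_right, nndist_eq_nnnorm, nndist_eq_nnnorm] at h
  exact h.trans (hθ.le j j q₁ q₂ p₁ p₂ le_rfl hq ((hp₁.trans_lt hq).trans_le hp₂) hp₁ hp₂ _)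

end ShiftExtend

section JointContinuity

open Filter Topology
open scoped Pointwise

variable {N : ℕ} {ω : ℕ+ → ℝ≥0 → ℝ≥0} [TopologicalSpace (ParamBMeasure N ω)]
  {S : Set (ParamBMeasure N ω)}

-- Joint continuity splits as `κ·τ = (κ - ν)·τ + ν·τ`.
theorem continuous_translate {ι : Type*} {p : SeminormFamily ℝ (ParamBMeasure N ω) ι}
    (hp : WithSeminorms p)
    (horbit : ∀ ν : ParamBMeasure N ω, Continuous fun t => ParamBMeasure.translate ν t)
    (hzero : ∀ i t (ε : ℝ), 0 < ε → ∃ q : Seminorm ℝ (ParamBMeasure N ω), Continuous q ∧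
      ∀ᶠ τ in 𝓝 t, ∀ μ ∈ S - S, p i (ParamBMeasure.translate μ τ) ≤ q μ + ε) :
    Continuous fun z : ℝ × S => ParamBMeasure.translate (z.2 : ParamBMeasure N ω) z.1 := by
  have := hp.topologicalAddGroup
  refine continuous_iff_continuousAt.2 fun ⟨t, ν⟩ => (hp.tendsto_nhds _ _).2 fun i ε hε => ?_
  obtain ⟨q, hq, hle⟩ := hzero i t (ε / 3) (by positivity)
  have hdiff : Tendsto (fun z : ℝ × S => q (z.2 - ν)) (𝓝 (t, ν)) (𝓝 0) := by
    have : Continuous fun z : ℝ × S => q (z.2 - ν) := by fun_prop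
    simpa only [sub_self, map_zero] using this.tendsto (t, ν)
  have hν := (hp.tendsto_nhds _ _).1 ((horbit ν).tendsto t) i (ε / 3) (by positivity)
  rw [nhds_prod_eq] at hdiff ⊢
  filter_upwards [hdiff.eventually_lt_const (by positivity : 0 < ε / 3),
    tendsto_fst.eventually hle, tendsto_fst.eventually hν] with ⟨τ, κ⟩ hκ hτ hντ
  calc p i (ParamBMeasure.translate κ.1 τ - ParamBMeasure.translate ν.1 t)
      = p i (ParamBMeasure.translate (κ.1 - ν.1) τ +
          (ParamBMeasure.translate ν.1 τ - ParamBMeasure.translate ν.1 t)) := by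
        rw [ParamBMeasure.translate_sub, sub_add_sub_cancel]
    _ ≤ p i (ParamBMeasure.translate (κ.1 - ν.1) τ) +
          p i (ParamBMeasure.translate ν.1 τ - ParamBMeasure.translate ν.1 t) :=
        map_add_le_add _ _ _
    _ < ε := by linarith [hτ _ (sub_mem_sub κ.2 ν.2)]

end JointContinuity

section SigmaD

open Filter Topology

variable {N : ℕ} {ω : ℕ+ → ℝ≥0 → ℝ≥0} [TopologicalSpace (ParamBMeasure N ω)]
  {D : Set (EuclideanSpace ℝ (Fin N))}

theorem continuous_translate_orbit_of_seminormFamilyD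
    (hp : WithSeminorms (seminormFamilyD (N := N) ω D)) (ν : ParamBMeasure N ω) :
    Continuous fun t => ParamBMeasure.translate ν t := by
  refine continuous_iff_continuousAt.2 fun t => (hp.tendsto_nhds _ _).2 fun i ε hε => ?_
  have happly (s : ℝ) : (ParamBMeasure.translate ν s).1 i.1 (Ioc (i.2.1.1 : ℝ) i.2.1.2) =
      (ν.1 i.1).cdf (i.2.1.2 + s) - (ν.1 i.1).cdf (i.2.1.1 + s) := by
    rw [ParamBMeasure.translate_apply_Ioc, BMeasure.apply_Ioc]
    exact add_le_add_left (Rat.cast_le.2 i.2.2.le) s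
  have hcont : Continuous fun s =>
      (ParamBMeasure.translate ν s).1 i.1 (Ioc (i.2.1.1 : ℝ) i.2.1.2) := by
    have := (ν.1 i.1).continuous_cdf
    simp only [happly]
    fun_prop
  filter_upwards [Metric.tendsto_nhds.1 (hcont.tendsto t) ε hε] with s hs
  rw [seminormFamilyD_apply]
  exact hs

theorem exists_seminormFamilyD_translate_le (hp : WithSeminorms (seminormFamilyD (N := N) ω D))
    {S : Set (ParamBMeasure N ω)} (hS : EquiOscOn D S) (i : D × {q : ℚ × ℚ // q.1 < q.2}) (t : ℝ)
    {ε : ℝ} (hε : 0 < ε) :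
    ∃ q : Seminorm ℝ (ParamBMeasure N ω), Continuous q ∧ ∀ᶠ τ in 𝓝 t, ∀ μ ∈ S,
      seminormFamilyD ω D i (ParamBMeasure.translate μ τ) ≤ q μ + ε := by
  obtain ⟨x, ⟨a, b⟩, hab⟩ := i
  have hab' : (a : ℝ) < b := Rat.cast_lt.2 hab
  obtain ⟨j, hj⟩ := exists_norm_le_pnat x.1
  obtain ⟨δ, hδ, hosc⟩ := hS j (ε / 2) (half_pos hε)
  obtain ⟨r₁, hr₁, hr₁'⟩ := exists_rat_btwn (sub_lt_self (a + t) (half_pos hδ))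
  obtain ⟨r₂, hr₂, hr₂'⟩ := exists_rat_btwn (lt_add_of_pos_right (b + t) (half_pos hδ))
  have hr : (r₁ : ℝ) < r₂ := by linarith
  refine ⟨seminormFamilyD ω D (x, ⟨(r₁, r₂), Rat.cast_lt.1 hr⟩), hp.continuous_seminorm _, ?_⟩
  filter_upwards [Metric.ball_mem_nhds t (half_pos hδ)] with τ hτ μ hμ
  obtain ⟨hτ₁, hτ₂⟩ := abs_lt.1 (Real.dist_eq τ t ▸ Metric.mem_ball.1 hτ)
  have hdiff := (hosc μ hμ x x.2 hj).abs_apply_Ioc_sub_le (add_le_add_left hab'.le τ) hr.le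
    (abs_lt.2 ⟨by linarith, by linarith⟩) (abs_lt.2 ⟨by linarith, by linarith⟩)
  rw [seminormFamilyD_apply, seminormFamilyD_apply, ParamBMeasure.translate_apply_Ioc]
  linarith [abs_sub_abs_le_abs_sub (μ.1 x (Ioc (a + τ) (b + τ))) (μ.1 x (Ioc r₁ r₂))]

theorem continuous_translate_of_seminormFamilyD
    (hp : WithSeminorms (seminormFamilyD (N := N) ω D)) {S : Set (ParamBMeasure N ω)}
    (hS : EquiOscOn D S) :
    Continuous fun z : ℝ × S => ParamBMeasure.translate (z.2 : ParamBMeasure N ω) z.1 :=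
  continuous_translate hp (continuous_translate_orbit_of_seminormFamilyD hp)
    fun i t _ hε => exists_seminormFamilyD_translate_le hp hS.sub i t hε

theorem continuous_apply_Ioc_of_seminormFamilyD
    (hp : WithSeminorms (seminormFamilyD (N := N) ω D)) {x : EuclideanSpace ℝ (Fin N)}
    (hx : x ∈ D) {q₁ q₂ : ℚ} (hq : q₁ < q₂) :
    Continuous fun ν : ParamBMeasure N ω => ν.1 x (Ioc (q₁ : ℝ) q₂) := by
  refine continuous_iff_continuousAt.2 fun ν => Metric.tendsto_nhds.2 fun ε hε => ?_
  exact (hp.tendsto_nhds id ν).1 tendsto_id (⟨x, hx⟩, ⟨(q₁, q₂), hq⟩) ε hε |>.mono fun κ hκ => by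
    rwa [seminormFamilyD_apply] at hκ

end SigmaD

section SigmaTheta

open Filter Topology MeasureTheory

variable {N : ℕ} {ω : ℕ+ → ℝ≥0 → ℝ≥0} {θ : ℕ+ → ℚ → ℚ → ℝ≥0 → ℝ≥0} {j : ℕ+} {q₁ q₂ : ℚ}
  {y : ℝ → EuclideanSpace ℝ (Fin N)}

theorem abs_apply_Ioc_le_seminormFamilyTheta (hω : IsModuliFamily ω) (hq : q₁ < q₂)
    (ν : ParamBMeasure N ω) {x : EuclideanSpace ℝ (Fin N)} (hx : ‖x‖ ≤ (j : ℝ)) :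
    |ν.1 x (Ioc (q₁ : ℝ) q₂)| ≤ seminormFamilyTheta N hω θ (j, ⟨(q₁, q₂), hq⟩) ν := by
  rw [← paramIntegral_const ν (Rat.cast_lt.2 hq)]
  exact abs_paramIntegral_le_toReal_seminormTheta hω hq ν
    ⟨continuousOn_const, fun _ _ => hx, fun _ _ _ _ => by simp⟩

theorem abs_paramIntegral_translate_sub_le (hω : IsModuliFamily ω) (hθ : IsSuitable θ)
    (hq : q₁ < q₂) {ν : ParamBMeasure N ω} {m l : Measure ℝ} (hm : IsMBound ν.1 j m)
    (hl : IsLBound ω ν.1 j l) (hy : y ∈ curveSet N θ j q₁ q₂) {a b s t : ℝ} (has : a < q₁ + s)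
    (hat : a < q₁ + t) (hsb : q₂ + s < b) (htb : q₂ + t < b) :
    |paramIntegral (ParamBMeasure.translate ν s - ParamBMeasure.translate ν t) q₁ q₂ y| ≤
      l.real (Ioc a b) * ω j (θ j q₁ q₂ (nndist s t)) +
        |(BMeasure.ofMeasure m hm.1).cdf (q₁ + s) - (BMeasure.ofMeasure m hm.1).cdf (q₁ + t)| +
        |(BMeasure.ofMeasure m hm.1).cdf (q₂ + s) - (BMeasure.ofMeasure m hm.1).cdf (q₂ + t)| := by
  have hq' : (q₁ : ℝ) < q₂ := Rat.cast_lt.2 hq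
  have hab : a < b := by linarith
  have hextend := abs_paramIntegral_sub_le (y := shiftExtend hq'.le s y)
    (z := shiftExtend hq'.le t y) (η := θ j q₁ q₂ (nndist s t)) hω hab hl
    (continuous_shiftExtend hq'.le s hy.1).continuousOn
    (fun r _ => norm_shiftExtend_le hq'.le s hy.2.1 r)
    (continuous_shiftExtend hq'.le t hy.1).continuousOn
    (fun r _ => norm_shiftExtend_le hq'.le t hy.2.1 r) fun r _ => by
      simpa only [nndist_sub_left] using nndist_shiftExtend_le hθ hq hq'.le hy s t r r
  have hleft := hm.abs_cdf_sub_le (hy.2.1 q₁ (left_mem_Icc.2 hq'.le)) (q₁ + t) (q₁ + s)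
  have hright := hm.abs_cdf_sub_le (hy.2.1 q₂ (right_mem_Icc.2 hq'.le)) (q₂ + t) (q₂ + s)
  rw [paramIntegral_shiftExtend hω ν hq' hy.1 hy.2.1 has hsb,
    paramIntegral_shiftExtend hω ν hq' hy.1 hy.2.1 hat htb, BMeasure.apply_Ioc _ has.le,
    BMeasure.apply_Ioc _ hat.le, BMeasure.apply_Ioc _ hsb.le,
    BMeasure.apply_Ioc _ htb.le] at hextend
  rw [paramIntegral_sub hω _ _ hq' hy.1 hy.2.1]
  rw [abs_le] at hextend hleft hright ⊢
  constructor <;> linarith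

theorem seminormFamilyTheta_translate_le (hω : IsModuliFamily ω) (hθ : IsSuitable θ)
    (hq : q₁ < q₂) {μ : ParamBMeasure N ω} {δ ε : ℝ}
    (hμ : ∀ x, ‖x‖ ≤ (j : ℝ) → (μ.1 x).OscLE δ ε) {p₁ p₂ r₁ r₂ : ℚ} (hp₁ : p₁ ≤ q₁)
    (hp₂ : q₂ ≤ p₂) (hr₁ : p₁ < r₁) (hr₂ : r₂ < p₂) {τ : ℝ} (hτ₁ : p₁ < q₁ + τ)
    (hτ₂ : q₂ + τ < p₂) (hδ₁ : |q₁ + τ - r₁| < δ) (hδ₂ : |q₂ + τ - r₂| < δ) :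
    seminormFamilyTheta N hω θ (j, ⟨(q₁, q₂), hq⟩) (ParamBMeasure.translate μ τ) ≤
      seminormFamilyTheta N hω θ (j, ⟨(p₁, p₂), (hp₁.trans_lt hq).trans_le hp₂⟩) μ +
        seminormFamilyTheta N hω θ (j, ⟨(p₁, r₁), hr₁⟩) μ +
        seminormFamilyTheta N hω θ (j, ⟨(r₂, p₂), hr₂⟩) μ + 4 * ε := by
  have hq' : (q₁ : ℝ) < q₂ := Rat.cast_lt.2 hq
  have hr₁' : (p₁ : ℝ) < r₁ := Rat.cast_lt.2 hr₁
  have hr₂' : (r₂ : ℝ) < p₂ := Rat.cast_lt.2 hr₂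
  have hδ : 0 < δ := (abs_nonneg _).trans_lt hδ₁
  have hε : 0 ≤ ε := (abs_nonneg _).trans (hμ 0 (by simp) 0 0 (by simpa using hδ))
  refine toReal_seminormTheta_le (by positivity) fun y hy => ?_
  have hwhole := abs_paramIntegral_le_toReal_seminormTheta hω
    ((hp₁.trans_lt hq).trans_le hp₂) μ (shiftExtend_mem_curveSet hθ hq hq'.le hp₁ hp₂ hy τ)
  have hy₁ := hy.2.1 q₁ (left_mem_Icc.2 hq'.le)
  have hy₂ := hy.2.1 q₂ (right_mem_Icc.2 hq'.le)
  have hleft := abs_apply_Ioc_le_seminormFamilyTheta (θ := θ) hω hr₁ μ hy₁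
  have hright := abs_apply_Ioc_le_seminormFamilyTheta (θ := θ) hω hr₂ μ hy₂
  have hosc₁ := (hμ _ hy₁).abs_apply_Ioc_sub_le hτ₁.le hr₁'.le (by simpa using hδ) hδ₁
  have hosc₂ := (hμ _ hy₂).abs_apply_Ioc_sub_le hτ₂.le hr₂'.le hδ₂ (by simpa using hδ)
  rw [paramIntegral_shiftExtend hω μ hq' hy.1 hy.2.1 hτ₁ hτ₂] at hwhole
  change _ ≤ seminormFamilyTheta N hω θ (j, ⟨(p₁, p₂), (hp₁.trans_lt hq).trans_le hp₂⟩) μ at hwhole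
  rw [abs_le] at hwhole hleft hright hosc₁ hosc₂ ⊢
  constructor <;> linarith

variable [TopologicalSpace (ParamBMeasure N ω)] {hω : IsModuliFamily ω}

theorem continuous_translate_orbit_of_seminormFamilyTheta
    (hp : WithSeminorms (seminormFamilyTheta N hω θ)) (hθ : IsSuitable θ)
    (ν : ParamBMeasure N ω) : Continuous fun t => ParamBMeasure.translate ν t := by
  refine continuous_iff_continuousAt.2 fun t => (hp.tendsto_nhds _ _).2 ?_
  rintro ⟨j, ⟨q₁, q₂⟩, hq⟩ ε hε
  obtain ⟨⟨m, hm⟩, l, hl⟩ := ν.2 j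
  have hbound : Continuous fun s : ℝ => l.real (Ioc (q₁ + t - 1) (q₂ + t + 1)) *
      ω j (θ j q₁ q₂ (nndist s t)) +
      |(BMeasure.ofMeasure m hm.1).cdf (q₁ + s) - (BMeasure.ofMeasure m hm.1).cdf (q₁ + t)| +
      |(BMeasure.ofMeasure m hm.1).cdf (q₂ + s) - (BMeasure.ofMeasure m hm.1).cdf (q₂ + t)| := by
    have := hω.continuous j
    have := hθ.continuous j q₁ q₂ hq
    have := (BMeasure.ofMeasure m hm.1).continuous_cdf
    fun_prop
  have hsmall := (hbound.tendsto t).eventually_lt_const (u := ε / 2) (by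
    simpa [hω.zero, hθ.zero j q₁ q₂ hq] using hε)
  filter_upwards [hsmall, Metric.ball_mem_nhds t one_pos] with s hs hst
  obtain ⟨hst₁, hst₂⟩ := abs_lt.1 (Real.dist_eq s t ▸ Metric.mem_ball.1 hst)
  refine lt_of_le_of_lt ?_ (half_lt_self hε)
  exact toReal_seminormTheta_le (half_pos hε).le fun y hy =>
    (abs_paramIntegral_translate_sub_le hω hθ hq hm hl hy (by linarith) (by linarith)
      (by linarith) (by linarith)).trans hs.le

theorem exists_seminormFamilyTheta_translate_le
    (hp : WithSeminorms (seminormFamilyTheta N hω θ)) (hθ : IsSuitable θ)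
    {S : Set (ParamBMeasure N ω)} (hS : EquiOscOn univ S)
    (i : ℕ+ × {q : ℚ × ℚ // q.1 < q.2}) (t : ℝ) {ε : ℝ} (hε : 0 < ε) :
    ∃ q : Seminorm ℝ (ParamBMeasure N ω), Continuous q ∧ ∀ᶠ τ in 𝓝 t, ∀ μ ∈ S,
      seminormFamilyTheta N hω θ i (ParamBMeasure.translate μ τ) ≤ q μ + ε := by
  obtain ⟨j, ⟨a, b⟩, hab⟩ := i
  obtain ⟨δ, hδ, hosc⟩ := hS j (ε / 4) (by positivity)
  obtain ⟨p₁, hp₁⟩ := exists_rat_lt (min (a : ℝ) (a + t - δ))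
  obtain ⟨p₂, hp₂⟩ := exists_rat_gt (max (b : ℝ) (b + t + δ))
  obtain ⟨r₁, hr₁, hr₁'⟩ := exists_rat_btwn (sub_lt_self (a + t) (half_pos hδ))
  obtain ⟨r₂, hr₂, hr₂'⟩ := exists_rat_btwn (lt_add_of_pos_right (b + t) (half_pos hδ))
  rw [lt_min_iff] at hp₁
  rw [max_lt_iff] at hp₂
  have hpa : p₁ ≤ a := Rat.cast_le.1 hp₁.1.le
  have hbp : b ≤ p₂ := Rat.cast_le.1 hp₂.1.le
  have hpr : p₁ < r₁ := by
    rw [← Rat.cast_lt (K := ℝ)]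
    linarith
  have hrp : r₂ < p₂ := by
    rw [← Rat.cast_lt (K := ℝ)]
    linarith
  refine ⟨seminormFamilyTheta N hω θ (j, ⟨(p₁, p₂), (hpa.trans_lt hab).trans_le hbp⟩) +
    seminormFamilyTheta N hω θ (j, ⟨(p₁, r₁), hpr⟩) +
    seminormFamilyTheta N hω θ (j, ⟨(r₂, p₂), hrp⟩),
    ((hp.continuous_seminorm _).add (hp.continuous_seminorm _)).add (hp.continuous_seminorm _), ?_⟩
  filter_upwards [Metric.ball_mem_nhds t (half_pos hδ)] with τ hτ μ hμ
  obtain ⟨hτ₁, hτ₂⟩ := abs_lt.1 (Real.dist_eq τ t ▸ Metric.mem_ball.1 hτ)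
  refine (seminormFamilyTheta_translate_le hω hθ hab (fun x hx => hosc μ hμ x (mem_univ x) hx) hpa
    hbp hpr hrp (by linarith) (by linarith) (abs_lt.2 ⟨by linarith, by linarith⟩)
    (abs_lt.2 ⟨by linarith, by linarith⟩)).trans_eq ?_
  simp only [add_apply]
  ring

theorem continuous_translate_of_seminormFamilyTheta
    (hp : WithSeminorms (seminormFamilyTheta N hω θ)) (hθ : IsSuitable θ)
    {S : Set (ParamBMeasure N ω)} (hS : EquiOscOn univ S) :
    Continuous fun z : ℝ × S => ParamBMeasure.translate (z.2 : ParamBMeasure N ω) z.1 :=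
  continuous_translate hp (continuous_translate_orbit_of_seminormFamilyTheta hp hθ)
    fun i t _ hε => exists_seminormFamilyTheta_translate_le hp hθ hS.sub i t hε

theorem continuous_apply_Ioc_of_seminormFamilyTheta
    (hp : WithSeminorms (seminormFamilyTheta N hω θ)) (x : EuclideanSpace ℝ (Fin N))
    {q₁ q₂ : ℚ} (hq : q₁ < q₂) :
    Continuous fun ν : ParamBMeasure N ω => ν.1 x (Ioc (q₁ : ℝ) q₂) := by
  obtain ⟨j, hj⟩ := exists_norm_le_pnat x
  refine continuous_iff_continuousAt.2 fun ν => Metric.tendsto_nhds.2 fun ε hε => ?_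
  exact (hp.tendsto_nhds id ν).1 tendsto_id (j, ⟨(q₁, q₂), hq⟩) ε hε |>.mono fun κ hκ =>
    (abs_apply_Ioc_le_seminormFamilyTheta hω hq (κ - ν) hj).trans_lt hκ

end SigmaTheta

section Flow

open MeasureTheory

variable {N : ℕ} {ω : ℕ+ → ℝ≥0 → ℝ≥0}

theorem EquicontinuousMeasures.exists_oscLE {Γ : Type*} {m : Γ → Measure ℝ}
    (h : EquicontinuousMeasures m) (hm : ∀ α, IsContMeasure (m α)) {ε : ℝ} (hε : 0 < ε) :
    ∃ δ > 0, ∀ α, (BMeasure.ofMeasure (m α) (hm α)).OscLE δ ε := by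
  obtain ⟨δ, hδ, h⟩ := h ε hε
  exact ⟨δ, hδ, fun α => BMeasure.oscLE_ofMeasure (hm α) hε.le fun s t hst hlt =>
    (h s t (sub_nonneg.2 hst) hlt α).le⟩

theorem FamilyEquicontMBounds.equiOscOn {Γ : Type*} {ν : Γ → ParamBMeasure N ω}
    (hν : FamilyEquicontMBounds ν) : EquiOscOn univ (range ν) := by
  obtain ⟨m, hm⟩ := hν
  intro j ε hε
  obtain ⟨δ, hδ, h⟩ := (hm j).2.exists_oscLE (fun α => ((hm j).1 α).1) hε
  refine ⟨δ, hδ, ?_⟩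
  rintro _ ⟨α, rfl⟩ x - hx s t hst
  exact (((hm j).1 α).abs_cdf_sub_le hx t s).trans (h α s t hst)

theorem EquiOscOn.mono {P Q : Set (EuclideanSpace ℝ (Fin N))} {S : Set (ParamBMeasure N ω)}
    (h : EquiOscOn Q S) (hPQ : P ⊆ Q) : EquiOscOn P S := fun j ε hε =>
  (h j ε hε).imp fun _ ⟨hδ, hosc⟩ => ⟨hδ, fun ν hν x hx => hosc ν hν x (hPQ hx)⟩

variable [TopologicalSpace (ParamBMeasure N ω)]

theorem EquiOscOn.closure {P : Set (EuclideanSpace ℝ (Fin N))} {S : Set (ParamBMeasure N ω)}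
    (h : EquiOscOn P S) (heval : ∀ x ∈ P, ∀ p q : ℚ, p < q →
      Continuous fun ν : ParamBMeasure N ω => ν.1 x (Ioc (p : ℝ) q)) :
    EquiOscOn P (closure S) := fun j ε hε => by
  obtain ⟨δ, hδ, hosc⟩ := h j ε hε
  refine ⟨δ, hδ, fun ν hν x hxP hx => BMeasure.oscLE_of_apply_Ioc_rat hε.le fun p q hpq hlt => ?_⟩
  have hsub : S ⊆ {κ | |κ.1 x (Ioc (p : ℝ) q)| ≤ ε} := fun κ hκ => by
    have hpq' : (p : ℝ) ≤ q := Rat.cast_le.2 hpq.le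
    rw [mem_ofPred_eq, BMeasure.apply_Ioc _ hpq']
    refine hosc κ hκ x hxP hx q p ?_
    rwa [abs_sub_comm, abs_sub_comm, abs_of_nonneg (sub_nonneg.2 hpq')]
  exact closure_minimal hsub (isClosed_le (heval x hxP p q hpq).abs continuous_const) hν

theorem exists_flow_hull (ν₀ : ParamBMeasure N ω)
    (hcont : Continuous fun z : ℝ × hull ν₀ =>
      ParamBMeasure.translate (z.2 : ParamBMeasure N ω) z.1) :
    ∃ φ : Flow ℝ (hull ν₀), ∀ (t : ℝ) (ν : hull ν₀),
      (φ t ν : ParamBMeasure N ω) = ParamBMeasure.translate (ν : ParamBMeasure N ω) t := by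
  have hinv (t : ℝ) : MapsTo (ParamBMeasure.translate · t) (hull ν₀) (hull ν₀) := by
    refine MapsTo.closure_of_continuousOn ?_ ?_
    · rintro _ ⟨s, rfl⟩
      exact ⟨s + t, (ParamBMeasure.translate_translate ν₀ s t).symm⟩
    · exact continuousOn_iff_continuous_domRestrict.2
        (hcont.comp (continuous_const.prodMk continuous_id))
  exact ⟨{
    toFun := fun t => (hinv t).restrict
    cont' := hcont.subtype_mk _
    map_add' := fun s t ν => Subtype.ext <| by
      rw [add_comm]
      exact (ParamBMeasure.translate_translate ν.1 t s).symm
    map_zero' := fun ν => Subtype.ext (ParamBMeasure.translate_zero ν.1) }, fun _ _ => rfl⟩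

end Flow

/-! ### Limits of parametric b-measures -/

section Limits

open MeasureTheory Topology Filter

namespace BMeasure

theorem OscLE.abs_cdf_nat_mul_le {μ : BMeasure} {δ c u : ℝ} (h : μ.OscLE δ c) (hu : |u| < δ)
    (n : ℕ) : |μ.cdf (n * u)| ≤ n * c := by
  induction n with
  | zero => simp [cdf_zero]
  | succ n ih =>
    push_cast
    have hstep : |μ.cdf ((n + 1) * u) - μ.cdf (n * u)| ≤ c :=
      h _ _ (by rwa [add_one_mul, add_sub_cancel_left])
    linarith [abs_sub_abs_le_abs_sub (μ.cdf ((n + 1) * u)) (μ.cdf (n * u))]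

theorem exists_forall_abs_cdf_le {Γ : Type*} {μ : Γ → BMeasure} {δ c : ℝ} (hδ : 0 < δ)
    (h : ∀ α, (μ α).OscLE δ c) (s : ℝ) : ∃ C, ∀ α, |(μ α).cdf s| ≤ C := by
  obtain ⟨n, hn⟩ := exists_nat_gt (|s| / δ)
  have hn0 : (0 : ℝ) < n := (by positivity : 0 ≤ |s| / δ).trans_lt hn
  have hs : |s / n| < δ := by
    rw [abs_div, Nat.abs_cast, div_lt_iff₀ hn0]
    rwa [div_lt_iff₀' hδ] at hn
  refine ⟨n * c, fun α => ?_⟩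
  simpa only [mul_div_cancel₀ s hn0.ne'] using (h α).abs_cdf_nat_mul_le hs n

theorem exists_tendsto_cdf {Γ : Type*} {μ : Γ → BMeasure} {δ c : ℝ} (hδ : 0 < δ)
    (h : ∀ α, (μ α).OscLE δ c) (F : Ultrafilter Γ) :
    ∃ g : ℝ → ℝ, ∀ s, Tendsto (fun α => (μ α).cdf s) F (𝓝 (g s)) := by
  have (s : ℝ) : ∃ x, Tendsto (fun α => (μ α).cdf s) F (𝓝 x) := by
    obtain ⟨C, hC⟩ := exists_forall_abs_cdf_le hδ h s
    obtain ⟨x, -, hx⟩ := (isCompact_Icc (a := -C) (b := C)).ultrafilter_le_nhds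
      (F.map fun α => (μ α).cdf s) (tendsto_principal.2 (.of_forall fun α => abs_le.1 (hC α)))
    exact ⟨x, hx⟩
  choose g hg using this
  exact ⟨g, hg⟩

end BMeasure

variable {Γ : Type*} {m l : Γ → Measure ℝ}

theorem EquicontinuousMeasures.exists_continuous_tendsto_cdf (h : EquicontinuousMeasures m)
    (hm : ∀ α, IsContMeasure (m α)) (F : Ultrafilter Γ) : ∃ M : ℝ → ℝ, Continuous M ∧
      ∀ s, Tendsto (fun α => (BMeasure.ofMeasure (m α) (hm α)).cdf s) F (𝓝 (M s)) := by
  obtain ⟨δ, hδ, hosc⟩ := h.exists_oscLE hm one_pos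
  obtain ⟨M, hM⟩ := BMeasure.exists_tendsto_cdf hδ hosc F
  refine ⟨M, Metric.continuous_iff.2 fun s ε hε => ?_, hM⟩
  obtain ⟨δ, hδ, hosc⟩ := h.exists_oscLE hm (half_pos hε)
  refine ⟨δ, hδ, fun t hts => lt_of_le_of_lt ?_ (half_lt_self hε)⟩
  exact le_of_tendsto' ((hM t).sub (hM s)).abs fun α => hosc α t s hts

theorem BoundedMeasures.exists_oscLE (h : BoundedMeasures l) (hl : ∀ α, IsContMeasure (l α)) :
    ∃ c, ∀ α, (BMeasure.ofMeasure (l α) (hl α)).OscLE 1 c := by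
  obtain ⟨c, hc, h⟩ := h
  exact ⟨c, fun α => BMeasure.oscLE_ofMeasure (hl α) hc.le fun s t _ hlt =>
    (measure_mono (Icc_subset_Icc_right (sub_le_iff_le_add'.1 hlt.le))).trans (h s α)⟩

theorem BoundedMeasures.exists_monotone_tendsto_cdf (h : BoundedMeasures l)
    (hl : ∀ α, IsContMeasure (l α)) (F : Ultrafilter Γ) : ∃ L : ℝ → ℝ, Monotone L ∧
      ∀ s, Tendsto (fun α => (BMeasure.ofMeasure (l α) (hl α)).cdf s) F (𝓝 (L s)) := by
  obtain ⟨c, hosc⟩ := h.exists_oscLE hl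
  obtain ⟨L, hL⟩ := BMeasure.exists_tendsto_cdf one_pos hosc F
  exact ⟨L, fun s t hst => le_of_tendsto_of_tendsto' (hL s) (hL t) fun α =>
    BMeasure.monotone_cdf_ofMeasure (hl α) hst, hL⟩

theorem BoundedMeasures.exists_measureReal_Ioc_le (h : BoundedMeasures l)
    (hl : ∀ α, IsContMeasure (l α)) (a b : ℝ) : ∃ C, ∀ α, (l α).real (Ioc a b) ≤ C := by
  rcases lt_or_ge b a with hba | hab
  · exact ⟨0, fun α => by simp [Ioc_eq_empty_of_le hba.le]⟩
  obtain ⟨c, hosc⟩ := h.exists_oscLE hl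
  obtain ⟨A, hA⟩ := BMeasure.exists_forall_abs_cdf_le one_pos hosc a
  obtain ⟨B, hB⟩ := BMeasure.exists_forall_abs_cdf_le one_pos hosc b
  refine ⟨B + A, fun α => ?_⟩
  rw [← BMeasure.cdf_ofMeasure_sub (hl α) hab]
  linarith [(abs_le.1 (hA α)).1, (abs_le.1 (hB α)).2]

end Limits

section Construction

open MeasureTheory Topology Filter

variable {N : ℕ} {ω : ℕ+ → ℝ≥0 → ℝ≥0} {ρ : EuclideanSpace ℝ (Fin N) → BMeasure} {j : ℕ+}

theorem atomlessPart_smul (c : ℝ≥0) (m : Measure ℝ) :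
    atomlessPart (c • m) = c • atomlessPart m := by
  rcases eq_or_ne c 0 with rfl | hc
  · simp [atomlessPart]
  · simp [atomlessPart, hc, Measure.restrict_smul]

theorem BMeasure.totalVar_le_smul_stieltjes (μ : BMeasure) {L : ℝ → ℝ} (hL : Monotone L)
    (c : ℝ≥0) (h : ∀ s t, s ≤ t → |μ (Ioc s t)| ≤ (L t - L s) * c) {A : Set ℝ}
    (hA : IsBoundedBorel A) : μ.totalVar A ≤ (c • hL.stieltjesFunction.measure) A := by
  rw [← StieltjesFunction.measure_smul]
  refine μ.totalVar_le_stieltjes _ (fun s t hst => ?_) hA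
  have hcdf (u : ℝ) : Tendsto (fun η => μ.cdf (u + η)) (𝓝[>] 0) (𝓝 (μ.cdf u)) := by
    have hc : Continuous fun η => μ.cdf (u + η) := μ.continuous_cdf.comp (by fun_prop)
    simpa using (hc.tendsto 0).mono_left nhdsWithin_le_nhds
  have hright (u : ℝ) : Tendsto (fun η => L (u + η)) (𝓝[>] 0) (𝓝 (Function.rightLim L u)) := by
    refine (hL.tendsto_rightLim u).comp (tendsto_nhdsWithin_iff.2 ⟨?_, ?_⟩)
    · have hc : Continuous fun η => u + η := by fun_prop
      simpa using (hc.tendsto 0).mono_left nhdsWithin_le_nhds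
    · filter_upwards [self_mem_nhdsWithin] with η hη using lt_add_of_pos_right u hη
  rw [μ.apply_Ioc hst]
  have key := le_of_tendsto_of_tendsto' ((hcdf t).sub (hcdf s)).abs
    (((hright t).sub (hright s)).mul_const (c : ℝ)) fun η => by
      rw [← μ.apply_Ioc (add_le_add_left hst η)]
      exact h _ _ (add_le_add_left hst η)
  refine key.trans_eq ?_
  change _ = (c : ℝ) * Function.rightLim L t - (c : ℝ) * Function.rightLim L s
  ring

theorem isMBound_stieltjes (M : StieltjesFunction ℝ) (hM : Continuous M)
    (h : ∀ x, ‖x‖ ≤ (j : ℝ) → ∀ s t, s ≤ t → |ρ x (Ioc s t)| ≤ M t - M s) :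
    IsMBound ρ j M.measure :=
  ⟨isContMeasure_stieltjes M hM, fun _ hA x hx => (ρ x).totalVar_le_stieltjes M (h x hx) hA⟩

theorem isLBound_atomlessPart {L : ℝ → ℝ} (hL : Monotone L)
    (h : ∀ x z, ‖x‖ ≤ (j : ℝ) → ‖z‖ ≤ (j : ℝ) → ∀ s t, s ≤ t →
      |(ρ x - ρ z) (Ioc s t)| ≤ (L t - L s) * ω j ‖x - z‖₊) :
    IsLBound ω ρ j (atomlessPart hL.stieltjesFunction.measure) := by
  refine ⟨isContMeasure_atomlessPart _, fun A hA x z hx hz => ?_⟩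
  have := (ρ x - ρ z).totalVar_le_atomlessPart
    (fun B hB => (ρ x - ρ z).totalVar_le_smul_stieltjes hL _ (h x z hx hz) hB) hA
  rw [atomlessPart_smul] at this
  rwa [mul_comm]

theorem exists_paramBMeasure (G : EuclideanSpace ℝ (Fin N) → ℝ → ℝ) (M L : ℕ+ → ℝ → ℝ)
    (hM : ∀ j, Continuous (M j)) (hL : ∀ j, Monotone (L j))
    (hGM : ∀ (j : ℕ+) x, ‖x‖ ≤ (j : ℝ) → ∀ s t, s ≤ t → |G x t - G x s| ≤ M j t - M j s)
    (hGL : ∀ (j : ℕ+) x z, ‖x‖ ≤ (j : ℝ) → ‖z‖ ≤ (j : ℝ) → ∀ s t, s ≤ t →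
      |(G x t - G x s) - (G z t - G z s)| ≤ (L j t - L j s) * ω j ‖x - z‖₊) :
    ∃ ν : ParamBMeasure N ω, ∀ x s t, s ≤ t → ν.1 x (Ioc s t) = G x t - G x s := by
  let k (j : ℕ+) : StieltjesFunction ℝ :=
    { toFun := M j
      mono' := fun s t hst => sub_nonneg.1 ((abs_nonneg _).trans (hGM j 0 (by simp) s t hst))
      right_continuous' := fun s => (hM j).continuousWithinAt }
  have hex (x : EuclideanSpace ℝ (Fin N)) :
      ∃ μ : BMeasure, ∀ s t, s ≤ t → μ (Ioc s t) = G x t - G x s := by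
    obtain ⟨j, hj⟩ := exists_norm_le_pnat x
    exact BMeasure.exists_apply_Ioc_eq (G x) (k j) (hM j) (hGM j x hj)
  choose ρ hρ using hex
  refine ⟨⟨ρ, fun j => ⟨⟨_, isMBound_stieltjes (k j) (hM j) fun x hx s t hst => ?_⟩,
    ⟨_, isLBound_atomlessPart (hL j) fun x z hx hz s t hst => ?_⟩⟩⟩, hρ⟩
  · rw [hρ x s t hst]
    exact hGM j x hx s t hst
  · rw [BMeasure.sub_apply, hρ x s t hst, hρ z s t hst]
    exact hGL j x z hx hz s t hst

theorem exists_tendsto_apply_Ioc {Γ : Type*} {ν : Γ → ParamBMeasure N ω}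
    (hm : FamilyEquicontMBounds ν) (hl : FamilyBoundedLBounds ν) (F : Ultrafilter Γ) :
    ∃ ν' : ParamBMeasure N ω, ∀ x s t,
      Tendsto (fun α => (ν α).1 x (Ioc s t)) F (𝓝 (ν'.1 x (Ioc s t))) := by
  have hG (x : EuclideanSpace ℝ (Fin N)) :
      ∃ g : ℝ → ℝ, ∀ s, Tendsto (fun α => ((ν α).1 x).cdf s) F (𝓝 (g s)) := by
    obtain ⟨j, hj⟩ := exists_norm_le_pnat x
    obtain ⟨δ, hδ, hosc⟩ := hm.equiOscOn j 1 one_pos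
    exact BMeasure.exists_tendsto_cdf hδ (fun α => hosc _ (mem_range_self α) x trivial hj) F
  obtain ⟨m, hm⟩ := hm
  obtain ⟨l, hl⟩ := hl
  have hmc (j : ℕ+) (α : Γ) : IsContMeasure (m j α) := ((hm j).1 α).1
  have hlc (j : ℕ+) (α : Γ) : IsContMeasure (l j α) := ((hl j).1 α).1
  choose G hG using hG
  choose M hMc hM using fun j => (hm j).2.exists_continuous_tendsto_cdf (hmc j) F
  choose L hLm hL using fun j => (hl j).2.exists_monotone_tendsto_cdf (hlc j) F
  obtain ⟨ν', hν'⟩ : ∃ ν' : ParamBMeasure N ω, ∀ x s t, s ≤ t →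
      ν'.1 x (Ioc s t) = G x t - G x s := by
    refine exists_paramBMeasure G M L hMc hLm (fun j x hx s t hst => ?_)
      fun j x z hx hz s t hst => ?_
    · refine le_of_tendsto_of_tendsto' ((hG x t).sub (hG x s)).abs ((hM j t).sub (hM j s))
        fun α => ?_
      rw [← BMeasure.apply_Ioc _ hst, BMeasure.cdf_ofMeasure_sub (hmc j α) hst]
      exact ((hm j).1 α).abs_apply_le (isBoundedBorel_Ioc s t) hx
    · refine le_of_tendsto_of_tendsto' (((hG x t).sub (hG x s)).sub ((hG z t).sub (hG z s))).abs
        (((hL j t).sub (hL j s)).mul_const _) fun α => ?_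
      rw [← BMeasure.apply_Ioc _ hst, ← BMeasure.apply_Ioc _ hst,
        BMeasure.cdf_ofMeasure_sub (hlc j α) hst]
      exact ((hl j).1 α).abs_sub_le (isBoundedBorel_Ioc s t) hx hz
  refine ⟨ν', fun x s t => ?_⟩
  rcases lt_or_ge t s with hts | hst
  · simp [Ioc_eq_empty_of_le hts.le, BMeasure.empty']
  rw [hν' x s t hst]
  simpa only [BMeasure.apply_Ioc _ hst] using (hG x t).sub (hG x s)

end Construction

/-! ### Compactness of the hull -/

section Compactness

open MeasureTheory Topology Filter

variable {N : ℕ} {ω : ℕ+ → ℝ≥0 → ℝ≥0} {θ : ℕ+ → ℚ → ℚ → ℝ≥0 → ℝ≥0} {j : ℕ+}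

theorem IsLBound.sub {ρ ρ' : EuclideanSpace ℝ (Fin N) → BMeasure} {l l' : Measure ℝ}
    (h : IsLBound ω ρ j l) (h' : IsLBound ω ρ' j l') : IsLBound ω (ρ - ρ') j (l + l') := by
  refine ⟨h.1.add h'.1, fun A hA x z hx hz => ?_⟩
  rw [mul_comm]
  refine BMeasure.totalVar_le_measure _ (m := ω j ‖x - z‖₊ • (l + l')) (fun B hB => ?_) hA
  calc ENNReal.ofReal |((ρ - ρ') x - (ρ - ρ') z) B|
      = ENNReal.ofReal |(ρ x - ρ z) B - (ρ' x - ρ' z) B| := by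
        simp only [Pi.sub_apply, BMeasure.sub_apply, sub_sub_sub_comm]
    _ ≤ ENNReal.ofReal |(ρ x - ρ z) B| + ENNReal.ofReal |(ρ' x - ρ' z) B| :=
        (ENNReal.ofReal_le_ofReal (abs_sub _ _)).trans ENNReal.ofReal_add_le
    _ ≤ l B * ω j ‖x - z‖₊ + l' B * ω j ‖x - z‖₊ := add_le_add
        ((BMeasure.ofReal_abs_le_totalVar _ hB.1).trans (h.2 B hB x z hx hz))
        ((BMeasure.ofReal_abs_le_totalVar _ hB.1).trans (h'.2 B hB x z hx hz))
    _ = (ω j ‖x - z‖₊ • (l + l')) B := by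
        rw [← add_mul, mul_comm]
        rfl

theorem IsSuitable.exists_forall_nndist_le (hθ : IsSuitable θ) (j : ℕ+) {q₁ q₂ : ℚ} (hq : q₁ < q₂)
    {η : ℝ≥0} (hη : 0 < η) : ∃ δ > 0, ∀ y ∈ curveSet N θ j q₁ q₂, ∀ s ∈ Icc (q₁ : ℝ) q₂,
      ∀ t ∈ Icc (q₁ : ℝ) q₂, |s - t| < δ → nndist (y s) (y t) ≤ η := by
  have hlim : Tendsto (θ j q₁ q₂) (𝓝[>] 0) (𝓝 0) := by
    simpa only [hθ.zero j q₁ q₂ hq] using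
      ((hθ.continuous j q₁ q₂ hq).tendsto 0).mono_left nhdsWithin_le_nhds
  obtain ⟨δ, hθδ, hδ⟩ := ((hlim.eventually_le_const hη).and self_mem_nhdsWithin).exists
  refine ⟨δ, hδ, fun y hy s hs t ht hst => ?_⟩
  rw [nndist_eq_nnnorm]
  exact (hy.2.2 s hs t ht).trans ((hθ.monotone j q₁ q₂ hq hst.le).trans hθδ)

/-- Curves in `𝓚_j^I` are uniformly close to step functions with steps on a fixed partition of `I`
and values in a fixed finite net of `B_j`. -/
theorem exists_toReal_seminormTheta_le (hω : IsModuliFamily ω) (hθ : IsSuitable θ) (j : ℕ+)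
    {q₁ q₂ : ℚ} (hq : q₁ < q₂) {η : ℝ≥0} (hη : 0 < η) :
    ∃ (n : ℕ) (t : ℕ → ℝ) (Z : Finset (EuclideanSpace ℝ (Fin N))),
      ∀ (ν : ParamBMeasure N ω) (l : Measure ℝ), IsLBound ω ν.1 j l →
        (seminormTheta θ j q₁ q₂ ν).toReal ≤ l.real (Ioc (q₁ : ℝ) q₂) * ω j η +
          ∑ i : Fin n, ∑ z ∈ Z, |ν.1 z (Ioc (t i) (t (i + 1)))| := by
  have hq' : (q₁ : ℝ) < q₂ := Rat.cast_lt.2 hq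
  obtain ⟨δ, hδ, hosc⟩ := hθ.exists_forall_nndist_le (N := N) j hq (half_pos hη)
  obtain ⟨n, t, τ, hP⟩ := exists_isTaggedPartition hq' hδ
  obtain ⟨Z, hZj, hZfin, hZ⟩ := (isCompact_closedBall (0 : EuclideanSpace ℝ (Fin N))
    (j : ℝ)).finite_cover_balls (e := (η / 2 : ℝ≥0)) (NNReal.coe_pos.2 (half_pos hη))
  refine ⟨n, t, hZfin.toFinset, fun ν l hl => toReal_seminormTheta_le (by positivity)
    fun y hy => ?_⟩
  have hnet (i : Fin n) : ∃ z ∈ Z, nndist (y (τ i)) z ≤ η / 2 := by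
    obtain ⟨z, hz, hyz⟩ :=
      mem_iUnion₂.1 (hZ (mem_closedBall_zero_iff.2 (hy.2.1 _ (hP.tag_mem_Icc i.2))))
    exact ⟨z, hz, le_of_lt hyz⟩
  choose z hzZ hyz using hnet
  have hstep := abs_paramIntegral_sub_sum_le hω hq' hl hy.1 hy.2.1 hP.isBorelPartition (x := z)
    (fun i => mem_closedBall_zero_iff.1 (hZj (hzZ i))) (η := η) fun i s hs => by
      rw [← add_halves η]
      refine (nndist_triangle _ (y (τ i)) _).trans (add_le_add ?_ (hyz i))
      refine hosc y hy s (Ioc_subset_Icc_self (hP.isBorelPartition.subset i hs)) _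
        (hP.tag_mem_Icc i.2) ?_
      rw [abs_sub_comm]
      exact hP.abs_tag_sub_lt i.2 hs
  have hsum : |∑ i, ν.1 (z i) (Ioc (t i) (t (i + 1)))| ≤
      ∑ i : Fin n, ∑ z ∈ hZfin.toFinset, |ν.1 z (Ioc (t i) (t (i + 1)))| :=
    (Finset.abs_sum_le_sum_abs _ _).trans <| Finset.sum_le_sum fun i _ =>
      Finset.single_le_sum (f := fun z => |ν.1 z (Ioc (t i) (t (i + 1)))|)
        (fun _ _ => abs_nonneg _) (hZfin.mem_toFinset.2 (hzZ i))
  linarith [abs_sub_abs_le_abs_sub (paramIntegral ν q₁ q₂ y)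
    (∑ i, ν.1 (z i) (Ioc (t i) (t (i + 1))))]

variable {Γ : Type*} {F : Filter Γ} {κ : Γ → ParamBMeasure N ω} {ν : ParamBMeasure N ω}

theorem tendsto_of_seminormFamilyTheta {hω : IsModuliFamily ω}
    [TopologicalSpace (ParamBMeasure N ω)] (hp : WithSeminorms (seminormFamilyTheta N hω θ))
    (hθ : IsSuitable θ) (hl : FamilyBoundedLBounds κ)
    (h : ∀ x s t, Tendsto (fun α => (κ α).1 x (Ioc s t)) F (𝓝 (ν.1 x (Ioc s t)))) :
    Tendsto κ F (𝓝 ν) := by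
  refine (hp.tendsto_nhds κ ν).2 ?_
  rintro ⟨j, ⟨q₁, q₂⟩, hq⟩ ε hε
  obtain ⟨l, hl⟩ := hl
  obtain ⟨-, l', hl'⟩ := ν.2 j
  obtain ⟨C, hC⟩ := (hl j).2.exists_measureReal_Ioc_le (fun α => ((hl j).1 α).1) q₁ q₂
  have hlim := hω.tendsto_mul_add j (C + l'.real (Ioc (q₁ : ℝ) q₂)) 0
  simp only [zero_add, hω.zero j, NNReal.coe_zero, mul_zero] at hlim
  obtain ⟨η, hηε, hη⟩ := ((hlim.eventually_lt_const (half_pos hε)).and self_mem_nhdsWithin).exists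
  obtain ⟨n, t, Z, hle⟩ := exists_toReal_seminormTheta_le (N := N) hω hθ j hq hη
  have hsum : Tendsto (fun α => ∑ i : Fin n, ∑ z ∈ Z,
      |(κ α).1 z (Ioc (t i) (t (i + 1))) - ν.1 z (Ioc (t i) (t (i + 1)))|) F (𝓝 0) := by
    simpa only [sub_self, abs_zero, Finset.sum_const_zero] using
      tendsto_finsetSum (Finset.univ : Finset (Fin n)) fun i _ => tendsto_finsetSum Z fun z _ =>
        ((h z (t i) (t (i + 1))).sub_const (ν.1 z (Ioc (t i) (t (i + 1))))).abs
  filter_upwards [hsum.eventually_lt_const (half_pos hε)] with α hα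
  change ∑ i : Fin n, ∑ z ∈ Z, |(κ α - ν).1 z (Ioc (t i) (t (i + 1)))| < ε / 2 at hα
  refine (hle (κ α - ν) _ (((hl j).1 α).sub hl')).trans_lt ?_
  have hreal : (l j α + l').real (Ioc (q₁ : ℝ) q₂) ≤ C + l'.real (Ioc (q₁ : ℝ) q₂) := by
    have := ((hl j).1 α).1.1
    have := hl'.1.1
    rw [measureReal_add_apply measure_Ioc_lt_top.ne measure_Ioc_lt_top.ne]
    exact add_le_add_left (hC α) _
  linarith [mul_le_mul_of_nonneg_right hreal (ω j η).coe_nonneg]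

theorem tendsto_of_seminormFamilyD {D : Set (EuclideanSpace ℝ (Fin N))}
    [TopologicalSpace (ParamBMeasure N ω)] (hp : WithSeminorms (seminormFamilyD ω D))
    (h : ∀ x ∈ D, ∀ s t, Tendsto (fun α => (κ α).1 x (Ioc s t)) F (𝓝 (ν.1 x (Ioc s t)))) :
    Tendsto κ F (𝓝 ν) := by
  refine (hp.tendsto_nhds κ ν).2 fun i ε hε => ?_
  simp only [seminormFamilyD_apply]
  exact Metric.tendsto_nhds.1 (h i.1 i.1.2 i.2.1.1 i.2.1.2) ε hε

theorem isCompact_closure_range {ν : Γ → ParamBMeasure N ω} [TopologicalSpace (ParamBMeasure N ω)]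
    [RegularSpace (ParamBMeasure N ω)] (hm : FamilyEquicontMBounds ν) (hl : FamilyBoundedLBounds ν)
    (hlim : ∀ (F : Filter Γ) (ν' : ParamBMeasure N ω),
      (∀ x s t, Tendsto (fun α => (ν α).1 x (Ioc s t)) F (𝓝 (ν'.1 x (Ioc s t)))) →
        Tendsto ν F (𝓝 ν')) : IsCompact (closure (range ν)) := by
  refine isCompact_closure_of_ultrafilter_le_nhds fun F hF => ?_
  have hne : (comap ν F).NeBot := comap_neBot_iff_compl_range.2 (Ultrafilter.compl_notMem_iff.2 hF)
  have hmap : (Ultrafilter.of (comap ν F)).map ν = F :=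
    Ultrafilter.coe_le_coe.1 (map_le_iff_le_comap.2 (Ultrafilter.of_le _))
  obtain ⟨ν', hν'⟩ := exists_tendsto_apply_Ioc hm hl (Ultrafilter.of (comap ν F))
  exact ⟨ν', hmap ▸ hlim _ ν' hν'⟩

end Compactness

theorem mainTheorem4_general (N : ℕ) (ω : ℕ+ → ℝ≥0 → ℝ≥0) (hω : IsModuliFamily ω)
    [T : TopologicalSpace (ParamBMeasure N ω)]
    (hT : (∃ θ : ℕ+ → ℚ → ℚ → ℝ≥0 → ℝ≥0, IsSuitable θ ∧ T = sigmaTheta N ω θ) ∨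
      (∃ D : Set (EuclideanSpace ℝ (Fin N)), T = sigmaD N ω D))
    (ν₀ : ParamBMeasure N ω) (hm : HasEquicontMBounds ν₀) :
    (∃ φ : Flow ℝ (hull ν₀), ∀ (t : ℝ) (ν : hull ν₀),
      (φ t ν : ParamBMeasure N ω) = ParamBMeasure.translate (ν : ParamBMeasure N ω) t) ∧
    (HasBoundedLBounds ν₀ → IsCompact (hull ν₀)) := by
  rcases hT with ⟨θ, hθ, rfl⟩ | ⟨D, rfl⟩
  · let := sigmaTheta N ω θ
    have hp := withSeminorms_sigmaTheta (N := N) hω θ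
    have := hp.topologicalAddGroup
    have hosc : EquiOscOn univ (hull ν₀) := hm.equiOscOn.closure fun x _ _ _ =>
      continuous_apply_Ioc_of_seminormFamilyTheta hp x
    exact ⟨exists_flow_hull ν₀ (continuous_translate_of_seminormFamilyTheta hp hθ hosc),
      fun hl => isCompact_closure_range hm hl fun _ _ h =>
        tendsto_of_seminormFamilyTheta hp hθ hl h⟩
  · let := sigmaD N ω D
    have hp := withSeminorms_sigmaD ω D
    have := hp.topologicalAddGroup
    have hosc : EquiOscOn D (hull ν₀) := (hm.equiOscOn.mono (subset_univ D)).closure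
      fun _ hx _ _ => continuous_apply_Ioc_of_seminormFamilyD hp hx
    exact ⟨exists_flow_hull ν₀ (continuous_translate_of_seminormFamilyD hp hosc),
      fun hl => isCompact_closure_range hm hl fun _ _ h =>
        tendsto_of_seminormFamilyD hp fun x _ => h x⟩

theorem mainTheorem4 (N : ℕ) (ω : ℕ+ → ℝ≥0 → ℝ≥0) (hω : IsModuliFamily ω)
    [T : TopologicalSpace (ParamBMeasure N ω)]
    (hT : (∃ θ : ℕ+ → ℚ → ℚ → ℝ≥0 → ℝ≥0, IsSuitable θ ∧ T = sigmaTheta N ω θ) ∨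
      (∃ D : Set (EuclideanSpace ℝ (Fin N)), D.Countable ∧ Dense D ∧ T = sigmaD N ω D))
    (ν₀ : ParamBMeasure N ω) (hm : HasEquicontMBounds ν₀) :
    (∃ φ : Flow ℝ (hull ν₀), ∀ (t : ℝ) (ν : hull ν₀),
      (φ t ν : ParamBMeasure N ω) = ParamBMeasure.translate (ν : ParamBMeasure N ω) t) ∧
    (HasBoundedLBounds ν₀ → IsCompact (hull ν₀)) :=
  mainTheorem4_general N ω hω (hT.imp_right fun ⟨D, _, _, h⟩ => ⟨D, h⟩) ν₀ hm
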